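/- **Setting.** Let $r\ge 1$, $0\le a<r$, $N\ge 0$ be integers, $U\in\mathbb C$, and $W:\mathbb C\to\mathbb C$ a function. A contour is a finite formal complex linear combination of curves. Let $C=\sum_k c_k\gamma_k$ be a contour whose curves are continuously differentiable on open (possibly unbounded) intervals, and put $\int_C f(x)\,dx=\sum_k c_k\int f(\gamma_k(t))\gamma_k'(t)\,dt$, and similarly $\int_{C^n}$ for functions of $n$ variables. Powers with non-integer exponents are principal. Let $\omega_r=e^{2\pi i/r}$, let $C^{1/r}_j$ be the image of $C$ under $x\mapsto\omega_r^jx^{1/r}$, and $C_{r,a}=\sum_{j=0}^{r-1}\omega_r^{-ja}C^{1/r}_j$. We suppose that for each curve $\gamma$ of $C$ the curve $\gamma^{1/r}$ is differentiable at almost every parameter value. For a function $O$ of $n$ (resp. $N$) variables let $$Z_{n,u}[O]=\frac1{n!}\int_{C^n}\prod_{i=1}^n\frac{dx_i}{2\pi}\,x_i^u\prod_{i<j}(x_i-x_j)^2\,e^{-\sum_iW(x_i)}\,O(x),\qquad \langle O\rangle_{n,u}=\frac{Z_{n,u}[O]}{Z_{n,u}[1]}$$ (parent model), and $$Z^{(r,a)}_{N,U}[O]=\frac1{N!}\int_{C_{r,a}^N}\prod_{i=1}^N\frac{dx_i}{2\pi}\,(x_i^r)^{U/r}\prod_{i<j}(x_i-x_j)^2\,e^{-\sum_iW(x_i^r)}\,O(x),\qquad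 \langle O\rangle^{(r,a)}_{N,U}=\frac{Z^{(r,a)}_{N,U}[O]}{Z^{(r,a)}_{N,U}[1]}$$ ($r$-fold model). For a partition $\lambda$ with at most $n$ nonzero parts, $s_\lambda(x_1,\dots,x_n)=\det(x_i^{n+\lambda_j-j})/\det(x_i^{n-j})$; if $\lambda$ has more than $n$ parts, $s_\lambda(x_1,\dots,x_n)=0$. For $0\le\mu<r$ let $I_{\mu,i}$ be the $i$-th integer $I\ge1$ with $I-\lambda_I-1\equiv\mu\pmod r$. Let $\widehat\sigma(I_{\mu,i})=1+r(i-1)+\mu$; the $r$-signature $\delta_r(\lambda)$ is the signature of $\widehat\sigma$ if $\widehat\sigma$ moves only finitely many integers, and $0$ otherwise. Let $(\lambda \bmod r)_\mu$ be the integer with $I_{\mu,i}=1+r\bigl(i-(\lambda\bmod r)_\mu-1\bigr)+\mu$ for all large $i$. The $r$-quotient of $\lambda$ consists of the partitions $\lambda/r^{(\mu)}$ with parts $$(\lambda/r^{(\mu)})_i=i-(\lambda\bmod r)_\mu-1+\frac{\lambda_{I_{\mu,i}}-I_{\mu,i}+\mu+1}{r}.$$ Finally let $$n_\mu=\Bigl\lfloor\tfrac{N-\mu-1}r\Bigr\rfloor+1,\qquad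 u_\mu=\frac{U+a}r+\Bigl\lfloor\tfrac{N-\mu-a-1}r\Bigr\rfloor-\Bigl\lfloor\tfrac{N-\mu-1}r\Bigr\rfloor .$$ **Theorem.** Let $\lambda$ be a partition with at most $N$ nonzero parts. Suppose that the moments $\int x^k(x^r)^{U/r}e^{-W(x^r)}\,dx$ along each curve of $C_{r,a}$ converge absolutely for all integers $0\le k\le 2N-2+\lambda_1$ (so that $Z^{(r,a)}_{N,U}[1]$ and $Z^{(r,a)}_{N,U}[s_\lambda]$ converge absolutely), and that $Z^{(r,a)}_{N,U}[1]\ne0$. Then for every $\mu$ the moments $\int x^{k+u_\mu}e^{-W(x)}\,dx$ along the curves of $C$ converge absolutely for $0\le k\le2n_\mu-2$, and $Z_{n_\mu,u_\mu}[1]\neq0$; if $\delta_r(\lambda)\ne0$, these moments converge absolutely for $0\le k\le 2n_\mu-2+(\lambda/r^{(\mu)})_1$; and $$\langle s_\lambda\rangle^{(r,a)}_{N,U}=\delta_r(\lambda)\prod_{\mu=0}^{r-1}\langle s_{\lambda/r^{(\mu)}}\rangle_{n_\mu,u_\mu},$$ where the right-hand side is $0$ if $\delta_r(\lambda)=0$.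 -/

import Mathlib

open MeasureTheory

noncomputable section

namespace MatrixModel

/-! ### Contours and integrals over them -/

/-- A parametrised curve in the complex plane; only its values on `domain` matter. -/
structure Curve where
  domain : Set ℝ
  toFun : ℝ → ℂ

/-- A continuously differentiable curve on an open (bounded or unbounded) interval. -/
structure Curve.IsSmooth (γ : Curve) : Prop where
  isOpen : IsOpen γ.domain
  ordConnected : γ.domain.OrdConnected
  contDiffOn : ContDiffOn ℝ 1 γ.toFun γ.domain

/-- A contour: a formal finite complex linear combination of curves. -/
abbrev Contour := Curve →₀ ℂ

/-- `∫_{C^n} F(x₁, …, xₙ) dx₁ ⋯ dxₙ`. -/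
def Contour.integral (C : Contour) (n : ℕ) (F : (Fin n → ℂ) → ℂ) : ℂ :=
  ∑ γ ∈ Fintype.piFinset (fun _ : Fin n => C.support),
    (∏ i, C (γ i)) *
      ∫ t in Set.univ.pi (fun i => (γ i).domain),
        F (fun i => (γ i).toFun (t i)) * ∏ i, deriv (γ i).toFun (t i)

/-- The primitive root of unity `ω_r = exp (2 π i / r)`. -/
def unitRoot (r : ℕ) : ℂ := Complex.exp (2 * Real.pi * Complex.I / r)

/-- The principal `r`-th root of a curve, rotated by `ω_r ^ j`. -/
def Curve.rotatedRoot (r j : ℕ) (γ : Curve) : Curve where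
  domain := γ.domain
  toFun t := unitRoot r ^ j * γ.toFun t ^ ((1 : ℂ) / r)

/-- `C_{r,a} = ∑_{j=0}^{r-1} ω_r^{-j a} C_j^{1/r}`. -/
def Contour.rfold (r a : ℕ) (C : Contour) : Contour :=
  ∑ j ∈ Finset.range r,
    unitRoot r ^ (-((j : ℤ) * a)) • Finsupp.mapDomain (Curve.rotatedRoot r j) C

/-! ### Eigenvalue models -/

/-- A one-matrix eigenvalue model: each eigenvalue `x` runs over `contour` and contributes the
factor `factor x * exp (-potential x)`. -/
structure Model where
  contour : Contour
  factor : ℂ → ℂ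
  potential : ℂ → ℂ

/-- The insertion
`Z_n[O] = (1/n!) ∫_{C^n} ∏ (dxᵢ/2π) factor(xᵢ) ∏_{i<j} (xᵢ - xⱼ)² exp(-∑ potential(xᵢ)) O(x)`. -/
def Model.insertion (M : Model) (n : ℕ) (O : (Fin n → ℂ) → ℂ) : ℂ :=
  (1 / (n.factorial : ℂ)) * M.contour.integral n (fun x =>
    (∏ i, M.factor (x i) / (2 * Real.pi)) * (∏ i, ∏ j ∈ Finset.Ioi i, (x i - x j) ^ 2) *
      Complex.exp (-∑ i, M.potential (x i)) * O x)

/-- The partition function `Z_n`. -/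
def Model.partitionFunction (M : Model) (n : ℕ) : ℂ := M.insertion n (fun _ => 1)

/-- The normalised average `⟨O⟩_n = Z_n[O] / Z_n`. -/
def Model.average (M : Model) (n : ℕ) (O : (Fin n → ℂ) → ℂ) : ℂ :=
  M.insertion n O / M.partitionFunction n

/-- Absolute convergence of the one-eigenvalue moments of order at most `2 n - 2 + l`.
These are the moments that occur when `Z_n` (for `l = 0`) or `Z_n[s_ν]` (for `l = ν₁`) is expanded
in monomials: each eigenvalue occurs in `∏_{i<j} (xᵢ - xⱼ)² s_ν(x)` with degree
at most `2 (n - 1) + ν₁`. -/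
def Model.Converges (M : Model) (n l : ℕ) : Prop :=
  ∀ γ ∈ M.contour.support, ∀ k : ℕ, k + 2 ≤ 2 * n + l →
    IntegrableOn (fun t => γ.toFun t ^ k * M.factor (γ.toFun t) *
      Complex.exp (-M.potential (γ.toFun t)) * deriv γ.toFun t) γ.domain

/-- The parent model with potential `W`, contour `C` and parameter `u`. -/
def parentModel (C : Contour) (W : ℂ → ℂ) (u : ℂ) : Model where
  contour := C
  factor x := x ^ u
  potential := W

/-- The `r`-fold model of phase `a` with parameter `U`. -/
def rfoldModel (C : Contour) (W : ℂ → ℂ) (r a : ℕ) (U : ℂ) : Model where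
  contour := C.rfold r a
  factor x := (x ^ r) ^ (U / r)
  potential x := W (x ^ r)

/-! ### Partitions

A partition is a Young diagram `lam`; its parts are `lam.rowLen 0 ≥ lam.rowLen 1 ≥ …` and
`lam.colLen 0` is the number of nonzero parts. Rows are numbered from `0`. -/

/-- The Schur polynomial `s_λ(x₁, …, xₙ) = det xᵢ^{n+λⱼ-j} / det xᵢ^{n-j}`, which is zero when `λ`
has more than `n` rows. (At coinciding arguments the quotient is `0/0`; in an average it is
multiplied by the squared denominator.) -/
def schur (lam : YoungDiagram) {n : ℕ} (x : Fin n → ℂ) : ℂ :=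
  if lam.colLen 0 ≤ n then
    (Matrix.of fun i j : Fin n => x i ^ (n - 1 - (j : ℕ) + lam.rowLen j)).det /
      (Matrix.of fun i j : Fin n => x i ^ (n - 1 - (j : ℕ))).det
  else 0

/-- The residue `(I - λ_I) mod r` of the row `I`. -/
def residue (r : ℕ) (lam : YoungDiagram) (I : ℕ) : ℕ :=
  (((I : ℤ) - lam.rowLen I) % r).toNat

/-- `I_{μ,i}`: the `i`-th row (counting from `0`) of residue `μ`. -/
def rowOfResidue (r : ℕ) (lam : YoungDiagram) (μ i : ℕ) : ℕ :=
  Nat.nth (fun I => residue r lam I = μ) i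

/-- The map `σ̂ : I_{μ,i} ↦ r i + μ`. -/
def sigmaHat (r : ℕ) (lam : YoungDiagram) (I : ℕ) : ℕ :=
  r * Nat.count (fun J => residue r lam J = residue r lam I) I + residue r lam I

open Classical in
/-- The signature, through the number of inversions, of an injective map of `ℕ`
that moves only finitely many points; zero for maps that move infinitely many. -/
def finitarySign (σ : ℕ → ℕ) : ℤ :=
  if {I | σ I ≠ I}.Finite then (-1) ^ {p : ℕ × ℕ | p.1 < p.2 ∧ σ p.2 < σ p.1}.ncard else 0

/-- The `r`-signature `δ_r(λ)`. -/
def rSignature (r : ℕ) (lam : YoungDiagram) : ℤ := finitarySign (sigmaHat r lam)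

/-- The remainder `(λ mod r)_μ`: the integer `i_μ` with `I_{μ,i} = r (i - i_μ) + μ` for all rows
`I_{μ,i}` below the diagram (see `rowOfResidue_eq`). It is read off from the number of rows of
residue `μ` among the first `r ℓ`, where `ℓ` is the number of nonzero parts. -/
def coreRemainder (r : ℕ) (lam : YoungDiagram) (μ : ℕ) : ℤ :=
  (Nat.count (fun I => residue r lam I = μ) (r * lam.colLen 0) : ℤ) - lam.colLen 0

/-- The parts of the `r`-quotient:
`(λ/r^{(μ)})_i = i - (λ mod r)_μ + (λ_{I_{μ,i}} - I_{μ,i} + μ) / r`. -/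
def quotientRow (r : ℕ) (lam : YoungDiagram) (μ i : ℕ) : ℤ :=
  i - coreRemainder r lam μ +
    ((lam.rowLen (rowOfResidue r lam μ i) : ℤ) - rowOfResidue r lam μ i + μ) / r

theorem rowLen_eq_zero {lam : YoungDiagram} {I : ℕ} (h : lam.colLen 0 ≤ I) :
    lam.rowLen I = 0 := by
  by_contra hne
  have h1 : (I, 0) ∈ lam := YoungDiagram.mem_iff_lt_rowLen.2 (Nat.pos_of_ne_zero hne)
  have h2 := YoungDiagram.mem_iff_lt_colLen.1 h1
  omega

theorem residue_of_le {r : ℕ} {lam : YoungDiagram} {I : ℕ} (h : lam.colLen 0 ≤ I) :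
    residue r lam I = I % r := by
  simp only [residue, rowLen_eq_zero h, Nat.cast_zero, sub_zero]
  rw [← Int.natCast_mod, Int.toNat_natCast]

theorem residue_infinite {r : ℕ} (lam : YoungDiagram) {μ : ℕ} (hμ : μ < r) :
    (Set.ofPred fun I => residue r lam I = μ).Infinite := by
  refine Set.infinite_of_injective_forall_mem (f := fun k => r * (lam.colLen 0 + k) + μ) ?_ ?_
  · intro x y hxy
    have hr : 0 < r := by omega
    have h1 : r * (lam.colLen 0 + x) = r * (lam.colLen 0 + y) := by
      simpa using hxy
    have := Nat.eq_of_mul_eq_mul_left hr h1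
    omega
  · intro k
    have h1 : lam.colLen 0 + k ≤ r * (lam.colLen 0 + k) := Nat.le_mul_of_pos_left _ (by omega)
    change residue r lam _ = μ
    rw [residue_of_le (by omega), Nat.mul_add_mod, Nat.mod_eq_of_lt hμ]

theorem residue_rowOfResidue {r : ℕ} (lam : YoungDiagram) {μ : ℕ} (hμ : μ < r) (i : ℕ) :
    residue r lam (rowOfResidue r lam μ i) = μ :=
  Nat.nth_mem_of_infinite (residue_infinite lam hμ) i

theorem rowOfResidue_strictMono {r : ℕ} (lam : YoungDiagram) {μ : ℕ} (hμ : μ < r) :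
    StrictMono (rowOfResidue r lam μ) :=
  Nat.nth_strictMono (residue_infinite lam hμ)

theorem count_mod {r μ : ℕ} (hμ : μ < r) (q s : ℕ) (hs : s ≤ μ) :
    Nat.count (fun I => I % r = μ) (r * q + s) = q := by
  have h0 : ∀ t ≤ r, Nat.count (fun I => I % r = μ) t = if μ < t then 1 else 0 := by
    intro t
    induction t with
    | zero => simp
    | succ t ih =>
      intro ht
      rw [Nat.count_succ, ih (by omega), Nat.mod_eq_of_lt (by omega : t < r)]
      grind
  have h1 : ∀ q, Nat.count (fun I => I % r = μ) (r * q) = q := by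
    intro q
    induction q with
    | zero => simp
    | succ q ih =>
      rw [Nat.mul_succ, Nat.count_add, ih]
      simp only [Nat.mul_add_mod]
      rw [h0 r le_rfl, if_pos hμ]
  rw [Nat.count_add, h1]
  simp only [Nat.mul_add_mod]
  rw [h0 s (by omega), if_neg (by omega)]
  rfl

/-- Below the diagram the rows of residue `μ` are `I_{μ,i} = r (i - (λ mod r)_μ) + μ`. -/
theorem rowOfResidue_eq {r : ℕ} (lam : YoungDiagram) {μ : ℕ} (hμ : μ < r) (i : ℕ)
    (h : lam.colLen 0 ≤ rowOfResidue r lam μ i) :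
    (rowOfResidue r lam μ i : ℤ) = r * (i - coreRemainder r lam μ) + μ := by
  set L := lam.colLen 0 with hL
  set p : ℕ → Prop := fun I => residue r lam I = μ with hp
  have key : ∀ d, (Nat.count p (L + d) : ℤ) - Nat.count (fun I => I % r = μ) (L + d) =
      (Nat.count p L : ℤ) - Nat.count (fun I => I % r = μ) L := by
    intro d
    induction d with
    | zero => rfl
    | succ d ih =>
      have e : p (L + d) ↔ (L + d) % r = μ := by
        simp only [hp]
        rw [residue_of_le (by omega)]
      rw [← Nat.add_assoc, Nat.count_succ, Nat.count_succ]
      by_cases hc : (L + d) % r = μ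
      · rw [if_pos hc, if_pos (e.2 hc)]; push_cast; linarith
      · rw [if_neg hc, if_neg (fun h => hc (e.1 h))]; push_cast; linarith
  set I := rowOfResidue r lam μ i with hI
  have hcount : Nat.count p I = i := Nat.count_nth_of_infinite (residue_infinite lam hμ) i
  have hIm : I % r = μ := by
    rw [← residue_of_le h]; exact residue_rowOfResidue lam hμ i
  have hdec : r * (I / r) + μ = I := by rw [← hIm]; exact Nat.div_add_mod I r
  have h1 := key (I - L)
  have h2 := key (r * L - L)
  have hrL : L ≤ r * L := Nat.le_mul_of_pos_left _ (by omega)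
  rw [show L + (I - L) = I by omega, hcount, ← hdec, count_mod hμ _ _ le_rfl] at h1
  rw [show L + (r * L - L) = r * L by omega] at h2
  have h3 := count_mod hμ L 0 (by omega)
  rw [Nat.add_zero] at h3
  rw [h3] at h2
  have h4 : (i : ℤ) - coreRemainder r lam μ = ((I / r : ℕ) : ℤ) := by
    simp only [coreRemainder]
    linarith
  rw [h4]
  exact_mod_cast hdec.symm

theorem mul_quotient_div {r : ℕ} (lam : YoungDiagram) {μ : ℕ} (hμ : μ < r) (i : ℕ) :
    (r : ℤ) * (((lam.rowLen (rowOfResidue r lam μ i) : ℤ) - rowOfResidue r lam μ i + μ) / r) =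
      (lam.rowLen (rowOfResidue r lam μ i) : ℤ) - rowOfResidue r lam μ i + μ := by
  apply Int.mul_ediv_cancel'
  have h := residue_rowOfResidue lam hμ i
  set I := rowOfResidue r lam μ i
  have hr : (r : ℤ) ≠ 0 := by omega
  have h1 : ((I : ℤ) - lam.rowLen I) % r = μ := by
    have h2 := Int.emod_nonneg ((I : ℤ) - lam.rowLen I) hr
    simp only [residue] at h
    omega
  refine ⟨-(((I : ℤ) - lam.rowLen I) / r), ?_⟩
  have h3 := Int.mul_ediv_add_emod ((I : ℤ) - lam.rowLen I) r
  rw [h1] at h3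
  linarith

theorem quotientRow_antitone {r : ℕ} (lam : YoungDiagram) {μ : ℕ} (hμ : μ < r) :
    Antitone (quotientRow r lam μ) := by
  refine antitone_nat_of_succ_le fun i => ?_
  have hlt := rowOfResidue_strictMono lam hμ (Nat.lt_succ_self i)
  have hanti := lam.rowLen_anti _ _ hlt.le
  have e1 := mul_quotient_div lam hμ i
  have e2 := mul_quotient_div lam hμ (i + 1)
  simp only [quotientRow]
  simp only [Nat.succ_eq_add_one] at hlt hanti
  set x := ((lam.rowLen (rowOfResidue r lam μ i) : ℤ) - rowOfResidue r lam μ i + μ) / r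
  set y := ((lam.rowLen (rowOfResidue r lam μ (i + 1)) : ℤ) -
    rowOfResidue r lam μ (i + 1) + μ) / r
  have h : (r : ℤ) * y < r * x := by rw [e1, e2]; omega
  have h2 : y < x := lt_of_mul_lt_mul_left h (by omega)
  push_cast
  omega

theorem quotientRow_eq_zero {r : ℕ} (lam : YoungDiagram) {μ : ℕ} (hμ : μ < r) {i : ℕ}
    (h : lam.colLen 0 ≤ rowOfResidue r lam μ i) : quotientRow r lam μ i = 0 := by
  have e1 := mul_quotient_div lam hμ i
  have e2 := rowOfResidue_eq lam hμ i h
  simp only [quotientRow]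
  rw [rowLen_eq_zero h] at e1 ⊢
  set x := (((0 : ℕ) : ℤ) - rowOfResidue r lam μ i + μ) / r
  have h3 : (r : ℤ) * (i - coreRemainder r lam μ + x) = 0 := by
    rw [mul_add, e1, e2]; push_cast; ring
  rcases mul_eq_zero.1 h3 with h4 | h4
  · omega
  · exact h4

theorem quotientRow_nonneg {r : ℕ} (lam : YoungDiagram) {μ : ℕ} (hμ : μ < r) (i : ℕ) :
    0 ≤ quotientRow r lam μ i := by
  have h1 : lam.colLen 0 ≤ rowOfResidue r lam μ (max i (lam.colLen 0)) :=
    (le_max_right _ _).trans ((rowOfResidue_strictMono lam hμ).le_apply)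
  rw [← quotientRow_eq_zero lam hμ h1]
  exact quotientRow_antitone lam hμ (le_max_left _ _)

/-- The component `λ/r^{(μ)}` of the `r`-quotient: the partition with parts `quotientRow r lam μ i`
(see `rowLen_quotient`). -/
def quotient (r : ℕ) (lam : YoungDiagram) (μ : Fin r) : YoungDiagram where
  cells := (Finset.range (lam.colLen 0) ×ˢ Finset.range (quotientRow r lam μ 0).toNat).filter
    fun c => (c.2 : ℤ) < quotientRow r lam μ c.1
  isLowerSet := by
    rintro ⟨i, j⟩ ⟨i', j'⟩ hle hc
    obtain ⟨hi, hj⟩ := Prod.mk_le_mk.1 hle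
    have := quotientRow_antitone lam μ.2 hi
    simp only [Finset.coe_filter, Finset.mem_product, Finset.mem_range, Set.mem_ofPred_eq] at hc ⊢
    omega

theorem rowLen_quotient (r : ℕ) (lam : YoungDiagram) (μ : Fin r) (i : ℕ) :
    ((quotient r lam μ).rowLen i : ℤ) = quotientRow r lam μ i := by
  have hnn := quotientRow_nonneg lam μ.2 i
  have h0 := quotientRow_antitone lam μ.2 (Nat.zero_le i)
  have hmem : ∀ j : ℕ, j < (quotient r lam μ).rowLen i ↔ (j : ℤ) < quotientRow r lam μ i := by
    intro j
    rw [← YoungDiagram.mem_iff_lt_rowLen, ← YoungDiagram.mem_cells]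
    simp only [quotient, Finset.mem_filter, Finset.mem_product, Finset.mem_range]
    refine ⟨fun h => h.2, fun h => ⟨⟨?_, by omega⟩, h⟩⟩
    by_contra hc
    have := quotientRow_eq_zero lam μ.2 (i := i)
      ((not_lt.1 hc).trans (rowOfResidue_strictMono lam μ.2).le_apply)
    omega
  have h1 := hmem (quotientRow r lam μ i).toNat
  have h2 := hmem ((quotient r lam μ).rowLen i)
  omega

/-! ### Parameters of the parent models -/

/-- `n_μ = ⌊(N - μ - 1) / r⌋ + 1`, which is nonnegative for `0 ≤ μ < r`. -/
def parentRank (N r μ : ℕ) : ℕ := (((N : ℤ) - μ - 1) / r + 1).toNat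

/-- `u_μ = (U + a) / r + ⌊(N - μ - a - 1) / r⌋ - ⌊(N - μ - 1) / r⌋`. -/
def parentParam (N r a : ℕ) (U : ℂ) (μ : ℕ) : ℂ :=
  (U + a) / r + ((((N : ℤ) - μ - a - 1) / r : ℤ) : ℂ) - ((((N : ℤ) - μ - 1) / r : ℤ) : ℂ)

end MatrixModel

end

noncomputable section

namespace MatrixModel

/-! ### Counting rows by residue -/

/-! Andréief's identity (`Model.insertion_eq_det`) turns `Z_N[s_λ]` into `(2π)^{-N}` times a
determinant of one-variable moments. The entry in row `i`, column `j` has order `p + (N-1-j+λ_j)`,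
where `p = N-1-i` and indices start at `0`.

In the `r`-fold model the rotated copies of a curve differ only by a phase, and their sum kills
every moment of order `K` with `K + 1` not congruent to `a` mod `r` (`moment_rfold`). The surviving
moments become moments of the parent model under `y = x^r` (`moment_rfold_eq_parent`). So a column
of residue `μ` meets only rows with `p ≡ a - N + μ`. Sorting rows and columns by class makes the
matrix block diagonal, and block `μ` is the moment matrix of the parent model `(n_μ, u_μ)` for the
quotient `λ/r^{(μ)}` (`det_momentMatrix_rfold`).

The row sorting does not depend on `λ`, and the column sorting differs from that of the empty
partition by `σ̂`. In the ratio with `λ = ∅` only the sign `δ_r(λ)` remains. Since `Z_N[1] ≠ 0`, the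
blocks of the empty partition are square (`Model.Sparse.rowsFit`). If `λ` has other residue counts,
its determinant vanishes (`Model.Sparse.balanced`), and this is exactly the case `δ_r(λ) = 0`
(`rSignature_ne_zero_iff`). -/

theorem count_residue_sub {r : ℕ} (lam : YoungDiagram) (μ : ℕ) {I : ℕ} (hI : lam.colLen 0 ≤ I) :
    (Nat.count (fun J => residue r lam J = μ) I : ℤ) - Nat.count (fun J => J % r = μ) I =
      (Nat.count (fun J => residue r lam J = μ) (lam.colLen 0) : ℤ) -
        Nat.count (fun J => J % r = μ) (lam.colLen 0) := by
  induction I, hI using Nat.le_induction with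
  | base => rfl
  | succ I hI ih =>
    rw [Nat.count_succ, Nat.count_succ, residue_of_le hI]
    push_cast
    linarith

/-- The difference of the two counts is constant below the diagram, so equality may be tested at any
depth there. -/
theorem count_residue_eq_of_le {r : ℕ} (lam : YoungDiagram) {μ I I' : ℕ}
    (hI : lam.colLen 0 ≤ I) (hI' : lam.colLen 0 ≤ I')
    (h : Nat.count (fun J => residue r lam J = μ) I = Nat.count (fun J => J % r = μ) I) :
    Nat.count (fun J => residue r lam J = μ) I' = Nat.count (fun J => J % r = μ) I' := by
  have h1 := count_residue_sub (r := r) lam μ hI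
  have h2 := count_residue_sub (r := r) lam μ hI'
  omega

/-- Each residue occurs among the first `N` rows as often as for the empty partition. -/
def Balanced (r N : ℕ) (lam : YoungDiagram) : Prop :=
  ∀ μ < r, Nat.count (fun J => residue r lam J = μ) N = Nat.count (fun J => J % r = μ) N

theorem residue_lt {r : ℕ} (hr : r ≠ 0) (lam : YoungDiagram) (I : ℕ) : residue r lam I < r := by
  have h1 := Int.emod_nonneg ((I : ℤ) - lam.rowLen I) (by omega : (r : ℤ) ≠ 0)
  have h2 := Int.emod_lt_of_pos ((I : ℤ) - lam.rowLen I) (by omega : (0 : ℤ) < r)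
  unfold residue
  omega

theorem count_mod_self {r : ℕ} (hr : r ≠ 0) (I : ℕ) :
    Nat.count (fun J => J % r = I % r) I = I / r := by
  have h := count_mod (Nat.mod_lt I (Nat.pos_of_ne_zero hr)) (I / r) (I % r) le_rfl
  rwa [Nat.div_add_mod] at h

theorem Balanced.sigmaHat_of_le {r N : ℕ} (hr : r ≠ 0) {lam : YoungDiagram}
    (hlam : lam.colLen 0 ≤ N) (hb : Balanced r N lam) {I : ℕ} (hI : N ≤ I) :
    sigmaHat r lam I = I := by
  have h := count_residue_eq_of_le lam hlam (hlam.trans hI)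
    (hb _ (Nat.mod_lt I (Nat.pos_of_ne_zero hr)))
  rw [sigmaHat, residue_of_le (hlam.trans hI), h, count_mod_self hr]
  exact Nat.div_add_mod I r

theorem Balanced.finite {r N : ℕ} (hr : r ≠ 0) {lam : YoungDiagram}
    (hlam : lam.colLen 0 ≤ N) (hb : Balanced r N lam) : {I | sigmaHat r lam I ≠ I}.Finite := by
  refine (Set.finite_Iio N).subset fun I hI => ?_
  by_contra h
  exact hI (hb.sigmaHat_of_le hr hlam (not_lt.1 h))

theorem balanced_of_finite {r N : ℕ} {lam : YoungDiagram}
    (hlam : lam.colLen 0 ≤ N) (hf : {I | sigmaHat r lam I ≠ I}.Finite) : Balanced r N lam := by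
  intro μ hμ
  have hr : r ≠ 0 := by omega
  obtain ⟨B, hB⟩ := hf.bddAbove
  -- The row `r * (B + N + 1) + μ` has residue `μ`, lies below the diagram and exceeds the bound `B`
  -- of the moved points. That `σ̂` fixes it determines the count.
  have h1 : B + N + 1 ≤ r * (B + N + 1) := Nat.le_mul_of_pos_left _ (by omega)
  have h2 : sigmaHat r lam (r * (B + N + 1) + μ) = r * (B + N + 1) + μ := by
    by_contra h
    have := hB h
    omega
  have h3 : residue r lam (r * (B + N + 1) + μ) = μ := by
    rw [residue_of_le (by omega), Nat.mul_add_mod, Nat.mod_eq_of_lt hμ]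
  refine count_residue_eq_of_le lam (I := r * (B + N + 1) + μ) (by omega) hlam ?_
  rw [count_mod hμ _ _ le_rfl]
  rw [sigmaHat, h3, Nat.add_right_cancel_iff] at h2
  exact Nat.eq_of_mul_eq_mul_left (Nat.pos_of_ne_zero hr) h2

theorem rSignature_ne_zero_iff {r N : ℕ} (hr : r ≠ 0) {lam : YoungDiagram}
    (hlam : lam.colLen 0 ≤ N) : rSignature r lam ≠ 0 ↔ Balanced r N lam := by
  unfold rSignature finitarySign
  refine ⟨fun h => balanced_of_finite hlam ?_, fun h => ?_⟩
  · by_contra hn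
    rw [if_neg hn] at h
    exact h rfl
  · rw [if_pos (h.finite hr hlam)]
    exact pow_ne_zero _ (by norm_num)

theorem Balanced.coreRemainder_eq_zero {r N : ℕ} {lam : YoungDiagram}
    (hlam : lam.colLen 0 ≤ N) (hb : Balanced r N lam) {μ : ℕ} (hμ : μ < r) :
    coreRemainder r lam μ = 0 := by
  have h := count_residue_eq_of_le lam hlam
    (Nat.le_mul_of_pos_left _ (by omega) : lam.colLen 0 ≤ r * lam.colLen 0) (hb μ hμ)
  have h2 := count_mod hμ (lam.colLen 0) 0 (Nat.zero_le _)
  rw [Nat.add_zero] at h2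
  rw [coreRemainder, h, h2, sub_self]

/-! ### Block sizes and the enumeration of the first `N` rows by residue. -/

theorem lt_parentRank_iff {N r μ i : ℕ} (hμ : μ < r) : i < parentRank N r μ ↔ r * i + μ < N := by
  have hr : (0 : ℤ) < r := by omega
  have h : (i : ℤ) ≤ ((N : ℤ) - μ - 1) / r ↔ (i : ℤ) * r ≤ (N : ℤ) - μ - 1 :=
    Int.le_ediv_iff_mul_le hr
  have h2 : ((r * i : ℕ) : ℤ) = (i : ℤ) * r := by push_cast; ring
  unfold parentRank
  omega

/-- The truncation `toNat` loses nothing, since `N - μ - 1 ≥ -r`. -/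
theorem cast_parentRank {N r μ : ℕ} (hμ : μ < r) :
    (parentRank N r μ : ℤ) = ((N : ℤ) - μ - 1) / r + 1 := by
  have hr : (0 : ℤ) < r := by omega
  have h : (-1 : ℤ) ≤ ((N : ℤ) - μ - 1) / r ↔ (-1 : ℤ) * r ≤ (N : ℤ) - μ - 1 :=
    Int.le_ediv_iff_mul_le hr
  unfold parentRank
  omega

theorem count_mod_eq_parentRank {N r μ : ℕ} (hμ : μ < r) :
    Nat.count (fun J => J % r = μ) N = parentRank N r μ := by
  apply le_antisymm
  · have h : N ≤ r * parentRank N r μ + μ := by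
      rw [← not_lt, ← lt_parentRank_iff hμ]; exact lt_irrefl _
    exact (Nat.count_monotone _ h).trans_eq (count_mod hμ _ _ le_rfl)
  · rcases Nat.eq_zero_or_pos (parentRank N r μ) with h0 | h0
    · omega
    · have h : r * (parentRank N r μ - 1) + μ < N := (lt_parentRank_iff hμ).1 (by omega)
      have h2 : Nat.count (fun J => J % r = μ) (r * (parentRank N r μ - 1) + μ + 1) =
          parentRank N r μ := by
        rw [Nat.count_succ, count_mod hμ _ _ le_rfl, if_pos]
        · omega
        · rw [Nat.mul_add_mod, Nat.mod_eq_of_lt hμ]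
      rw [← h2]
      exact Nat.count_monotone _ h

theorem rowOfResidue_count {r : ℕ} (lam : YoungDiagram) (I : ℕ) :
    rowOfResidue r lam (residue r lam I)
      (Nat.count (fun J => residue r lam J = residue r lam I) I) = I :=
  Nat.nth_count (p := fun J => residue r lam J = residue r lam I) rfl

theorem count_rowOfResidue {r : ℕ} (lam : YoungDiagram) {μ : ℕ} (hμ : μ < r) (s : ℕ) :
    Nat.count (fun J => residue r lam J = μ) (rowOfResidue r lam μ s) = s :=
  Nat.count_nth_of_infinite (residue_infinite lam hμ) s

theorem sigmaHat_rowOfResidue {r : ℕ} (lam : YoungDiagram) {μ : ℕ} (hμ : μ < r) (s : ℕ) :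
    sigmaHat r lam (rowOfResidue r lam μ s) = r * s + μ := by
  rw [sigmaHat, residue_rowOfResidue lam hμ, count_rowOfResidue lam hμ]

/-- The positions in the blocks of sizes `n_μ`. -/
abbrev BlockIndex (N r : ℕ) : Type := Σ μ : Fin r, Fin (parentRank N r μ)

theorem Balanced.rowOfResidue_lt {r N : ℕ} {lam : YoungDiagram} (hb : Balanced r N lam) {μ : ℕ}
    (hμ : μ < r) {s : ℕ} (hs : s < parentRank N r μ) : rowOfResidue r lam μ s < N := by
  apply Nat.nth_lt_of_lt_count
  rwa [hb μ hμ, count_mod_eq_parentRank hμ]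

/-- The enumeration `(μ, s) ↦ I_{μ,s}` of the first `N` rows. -/
def columnMap {r N : ℕ} {lam : YoungDiagram} (hb : Balanced r N lam) (x : BlockIndex N r) :
    Fin N :=
  ⟨rowOfResidue r lam x.1 x.2, hb.rowOfResidue_lt x.1.2 x.2.2⟩

theorem columnMap_bijective {r N : ℕ} (hr : r ≠ 0) {lam : YoungDiagram}
    (hb : Balanced r N lam) : Function.Bijective (columnMap hb) := by
  constructor
  · rintro ⟨μ, s⟩ ⟨μ', s'⟩ h
    have h1 : rowOfResidue r lam μ s = rowOfResidue r lam μ' s' := congrArg Fin.val h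
    have h2 : μ = μ' := by
      apply Fin.ext
      rw [← residue_rowOfResidue lam μ.2 s, h1, residue_rowOfResidue lam μ'.2]
    subst h2
    have h3 : s = s' := Fin.ext ((rowOfResidue_strictMono lam μ.2).injective h1)
    rw [h3]
  · intro I
    have hμ := residue_lt hr lam I
    refine ⟨⟨⟨residue r lam I, hμ⟩,
      ⟨Nat.count (fun J => residue r lam J = residue r lam I) I, ?_⟩⟩,
      Fin.ext (rowOfResidue_count lam I)⟩
    rw [← count_mod_eq_parentRank hμ, ← hb _ hμ]
    exact Nat.count_strict_mono rfl I.2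

def columnEquiv {r N : ℕ} (hr : r ≠ 0) {lam : YoungDiagram}
    (hb : Balanced r N lam) : BlockIndex N r ≃ Fin N :=
  Equiv.ofBijective _ (columnMap_bijective hr hb)

theorem columnEquiv_apply {r N : ℕ} (hr : r ≠ 0) {lam : YoungDiagram}
    (hb : Balanced r N lam) (x : BlockIndex N r) :
    (columnEquiv hr hb x : ℕ) = rowOfResidue r lam x.1 x.2 := rfl

/-! ### The empty partition -/

theorem colLen_bot (i : ℕ) : (⊥ : YoungDiagram).colLen i = 0 := by
  by_contra h
  exact YoungDiagram.notMem_bot _ (YoungDiagram.mem_iff_lt_colLen.2 (Nat.pos_of_ne_zero h))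

theorem rowLen_bot (i : ℕ) : (⊥ : YoungDiagram).rowLen i = 0 :=
  rowLen_eq_zero (by rw [colLen_bot]; exact Nat.zero_le _)

theorem residue_bot (r I : ℕ) : residue r ⊥ I = I % r :=
  residue_of_le (by rw [colLen_bot]; exact Nat.zero_le _)

theorem balanced_bot (r N : ℕ) : Balanced r N ⊥ := fun μ _ => by simp_rw [residue_bot]

theorem rowLen_quotient_bot (r : ℕ) (μ : Fin r) (i : ℕ) : (quotient r ⊥ μ).rowLen i = 0 := by
  have h := rowLen_quotient r ⊥ μ i
  rw [quotientRow_eq_zero ⊥ μ.2 (by rw [colLen_bot]; exact Nat.zero_le _)] at h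
  exact_mod_cast h

theorem rowOfResidue_bot {r μ : ℕ} (hμ : μ < r) (s : ℕ) : rowOfResidue r ⊥ μ s = r * s + μ := by
  have hr : r ≠ 0 := by omega
  rw [← sigmaHat_rowOfResidue ⊥ hμ]
  exact ((balanced_bot r 0).sigmaHat_of_le hr (by rw [colLen_bot]) (Nat.zero_le _)).symm

/-! ### The signature -/

/-- Both sides count inversions. As `f` preserves `[0, N)` and is the identity beyond it, no
inversion involves an index `≥ N`. -/
theorem finitarySign_eq_sign {N : ℕ} (f : ℕ → ℕ) (σ : Equiv.Perm (Fin N))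
    (h : ∀ i : Fin N, f i = σ i) (h' : ∀ I, N ≤ I → f I = I) :
    finitarySign f = (Equiv.Perm.sign σ : ℤ) := by
  classical
  have hfin : {I | f I ≠ I}.Finite := by
    refine (Set.finite_Iio N).subset fun I hI => ?_
    by_contra hn
    exact hI (h' I (not_lt.1 hn))
  have hlt : ∀ i, i < N → f i < N := fun i hi => by
    rw [h ⟨i, hi⟩]; exact (σ _).2
  rw [finitarySign, if_pos hfin, Equiv.Perm.sign_eq_prod_prod_Ioi]
  have hset : {p : ℕ × ℕ | p.1 < p.2 ∧ f p.2 < f p.1} =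
      (((Finset.univ : Finset (Fin N × Fin N)).filter fun p => p.1 < p.2 ∧ σ p.2 < σ p.1).map
        ⟨fun p => ((p.1 : ℕ), (p.2 : ℕ)), fun p q hpq => by
          simp only [Prod.mk.injEq] at hpq
          exact Prod.ext (Fin.ext hpq.1) (Fin.ext hpq.2)⟩ : Finset (ℕ × ℕ)) := by
    ext ⟨i, j⟩
    simp only [Set.mem_ofPred_eq, Finset.coe_map, Finset.coe_filter, Set.mem_image, Prod.exists,
      Finset.mem_univ, true_and]
    constructor
    · rintro ⟨hij, hf⟩
      have hj : j < N := by
        by_contra hj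
        rw [h' j (not_lt.1 hj)] at hf
        by_cases hi : i < N
        · have := hlt i hi; omega
        · rw [h' i (not_lt.1 hi)] at hf; omega
      refine ⟨⟨i, by omega⟩, ⟨j, hj⟩, ⟨hij, ?_⟩, rfl⟩
      rw [Fin.lt_def, ← h, ← h]
      exact hf
    · rintro ⟨i', j', ⟨hij, hf⟩, he⟩
      cases he
      refine ⟨hij, ?_⟩
      rw [h, h]
      exact hf
  rw [hset, Set.ncard_coe_finset, Finset.card_map]
  have h1 : ∀ i j : Fin N, j ∈ Finset.Ioi i → (if σ i < σ j then (1 : ℤˣ) else -1) =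
      if i < j ∧ σ j < σ i then -1 else 1 := by
    intro i j hij
    rw [Finset.mem_Ioi] at hij
    have hne : σ i ≠ σ j := fun he => hij.ne (σ.injective he)
    rcases lt_or_gt_of_ne hne with hlt | hlt
    · rw [if_pos hlt, if_neg (fun hc => lt_asymm hlt hc.2)]
    · rw [if_neg (lt_asymm hlt), if_pos ⟨hij, hlt⟩]
  have h2 : ∏ i, ∏ j ∈ Finset.Ioi i, (if σ i < σ j then (1 : ℤˣ) else -1) =
      ∏ p : Fin N × Fin N, if p.1 < p.2 ∧ σ p.2 < σ p.1 then -1 else 1 := by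
    rw [Fintype.prod_prod_type]
    refine Finset.prod_congr rfl fun i _ => ?_
    rw [Finset.prod_congr rfl (h1 i)]
    refine Finset.prod_subset (Finset.subset_univ _) fun j _ hj => ?_
    rw [Finset.mem_Ioi] at hj
    rw [if_neg (fun hc => hj hc.1)]
  rw [h2, Finset.prod_ite, Finset.prod_const_one, mul_one, Finset.prod_const]
  simp

/-- On the first `N` rows, `σ̂` replaces `I_{μ,s}` by `r s + μ`, which is the `s`-th row of residue
`μ` of the empty partition. -/
theorem Balanced.rSignature_eq {r N : ℕ} (hr : r ≠ 0) {lam : YoungDiagram}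
    (hlam : lam.colLen 0 ≤ N) (hb : Balanced r N lam) :
    rSignature r lam = (Equiv.Perm.sign
      ((columnEquiv hr hb).symm.trans (columnEquiv hr (balanced_bot r N))) : ℤ) := by
  refine finitarySign_eq_sign _ _ (fun i => ?_) fun I hI => hb.sigmaHat_of_le hr hlam hI
  obtain ⟨x, rfl⟩ := (columnEquiv hr hb).surjective i
  rw [Equiv.trans_apply, Equiv.symm_apply_apply, columnEquiv_apply, columnEquiv_apply,
    sigmaHat_rowOfResidue lam x.1.2, rowOfResidue_bot x.1.2]

theorem rSignature_bot (r : ℕ) (hr : r ≠ 0) : rSignature r ⊥ = 1 := by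
  rw [(balanced_bot r 0).rSignature_eq hr (by rw [colLen_bot])]
  simp

/-! ### Determinants of sparse matrices -/

theorem exists_perm_of_det_ne_zero {R n : Type*} [CommRing R] [Fintype n] [DecidableEq n]
    {A : Matrix n n R} (h : A.det ≠ 0) : ∃ σ : Equiv.Perm n, ∀ i, A (σ i) i ≠ 0 := by
  by_contra! hn
  apply h
  rw [Matrix.det_apply]
  refine Finset.sum_eq_zero fun σ _ => ?_
  obtain ⟨i, hi⟩ := hn σ
  have h0 : ∏ i, A (σ i) i = 0 := Finset.prod_eq_zero (Finset.mem_univ i) hi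
  exact (congrArg _ h0).trans (smul_zero _)

theorem det_eq_prod_of_sigma {R o : Type*} [CommRing R] [Fintype o] [DecidableEq o] {k : o → ℕ}
    (A : Matrix (Σ μ, Fin (k μ)) (Σ μ, Fin (k μ)) R)
    (h : ∀ x y, x.1 ≠ y.1 → A x y = 0) :
    A.det = ∏ μ, (Matrix.of fun i j : Fin (k μ) => A ⟨μ, i⟩ ⟨μ, j⟩).det := by
  classical
  -- The order is arbitrary; it serves only to view a block diagonal matrix as block triangular.
  let _ : LinearOrder o := LinearOrder.lift' (Fintype.equivFin o) (Fintype.equivFin o).injective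
  have hb : A.BlockTriangular Sigma.fst := fun x y hxy => h x y (ne_of_gt hxy)
  rw [hb.det_fintype]
  refine Finset.prod_congr rfl fun μ _ => ?_
  rw [← Matrix.det_submatrix_equiv_self (Equiv.sigmaSubtype (β := fun μ => Fin (k μ)) μ).symm]
  rfl

/-! ### Andréief's identity -/

/-- The integral over a contour of a product of functions of one variable, expanded as a sum. -/
theorem Contour.integral_sum_prod {ι : Type*} (C : Contour) (n : ℕ) (s : Finset ι) (c : ι → ℂ)
    (H : ι → Fin n → ℂ → ℂ)
    (hH : ∀ γ ∈ C.support, ∀ a ∈ s, ∀ i,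
      IntegrableOn (fun t => H a i (γ.toFun t) * deriv γ.toFun t) γ.domain) :
    C.integral n (fun x => ∑ a ∈ s, c a * ∏ i, H a i (x i)) =
      ∑ a ∈ s, c a * ∏ i, ∑ γ ∈ C.support,
        C γ * ∫ t in γ.domain, H a i (γ.toFun t) * deriv γ.toFun t := by
  classical
  -- The product over the variables of sums over curves becomes a sum over tuples of curves; Fubini
  -- then applies to each tuple.
  simp_rw [Finset.prod_univ_sum]
  unfold Contour.integral
  simp_rw [Finset.mul_sum (s := Fintype.piFinset _)]
  rw [Finset.sum_comm]
  refine Finset.sum_congr rfl fun γ hγ => ?_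
  rw [Fintype.mem_piFinset] at hγ
  have hint : ∀ a ∈ s, Integrable (fun t : Fin n → ℝ =>
      c a * ∏ i, (H a i ((γ i).toFun (t i)) * deriv (γ i).toFun (t i)))
      (volume.restrict (Set.univ.pi fun i => (γ i).domain)) := by
    intro a ha
    rw [volume_pi, Measure.restrict_pi_pi]
    exact (Integrable.fintype_prod fun i => hH (γ i) (hγ i) a ha i).const_mul _
  have heq : ∀ t : Fin n → ℝ, (∑ a ∈ s, c a * ∏ i, H a i ((γ i).toFun (t i))) *
      ∏ i, deriv (γ i).toFun (t i) =
      ∑ a ∈ s, c a * ∏ i, (H a i ((γ i).toFun (t i)) * deriv (γ i).toFun (t i)) := by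
    intro t
    rw [Finset.sum_mul]
    refine Finset.sum_congr rfl fun a _ => ?_
    rw [Finset.prod_mul_distrib, mul_assoc]
  simp_rw [heq]
  rw [integral_finsetSum _ hint, Finset.mul_sum]
  refine Finset.sum_congr rfl fun a _ => ?_
  rw [integral_const_mul, volume_pi, Measure.restrict_pi_pi,
    integral_fintype_prod_eq_prod
      (fun (i : Fin n) (t : ℝ) => H a i ((γ i).toFun t) * deriv (γ i).toFun t),
    Finset.prod_mul_distrib]
  ring

/-- The integrand of the moment of order `k` along a curve. -/
def Model.momentIntegrand (M : Model) (γ : Curve) (k : ℕ) (t : ℝ) : ℂ :=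
  γ.toFun t ^ k * M.factor (γ.toFun t) * Complex.exp (-M.potential (γ.toFun t)) *
    deriv γ.toFun t

/-- The one-eigenvalue moment of order `k`. -/
def Model.moment (M : Model) (k : ℕ) : ℂ :=
  ∑ γ ∈ M.contour.support, M.contour γ * ∫ t in γ.domain, M.momentIntegrand γ k t

/-- The matrix of moments whose determinant computes the insertion of a Schur polynomial. -/
def Model.momentMatrix (M : Model) {n : ℕ} (g : Fin n → ℕ) : Matrix (Fin n) (Fin n) ℂ :=
  Matrix.of fun i j => M.moment (n - 1 - (i : ℕ) + g j)

/-- For fixed `τ` the sum over `σ` is the determinant with columns permuted by `τ`, whose sign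
cancels against that of `τ`. Hence `n!` equal terms. -/
theorem sum_sign_mul_sign_prod {R : Type*} [CommRing R] {n : ℕ} (A : Matrix (Fin n) (Fin n) R) :
    ∑ p : Equiv.Perm (Fin n) × Equiv.Perm (Fin n),
      ((Equiv.Perm.sign p.1 : ℤ) : R) * ((Equiv.Perm.sign p.2 : ℤ) : R) *
        ∏ i, A (p.1 i) (p.2 i) = n.factorial * A.det := by
  rw [Fintype.sum_prod_type_right]
  have h : ∀ τ : Equiv.Perm (Fin n), ∑ σ : Equiv.Perm (Fin n),
      ((Equiv.Perm.sign σ : ℤ) : R) * ((Equiv.Perm.sign τ : ℤ) : R) * ∏ i, A (σ i) (τ i) =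
      A.det := by
    intro τ
    have h1 := Matrix.det_permute' τ A
    rw [Matrix.det_apply'] at h1
    simp only [Matrix.submatrix_apply, id] at h1
    have h2 : ((Equiv.Perm.sign τ : ℤ) : R) * ((Equiv.Perm.sign τ : ℤ) : R) = 1 := by
      rw [← Int.cast_mul, ← Units.val_mul, Int.units_mul_self]; simp
    calc _ = ((Equiv.Perm.sign τ : ℤ) : R) * ∑ σ : Equiv.Perm (Fin n),
          ((Equiv.Perm.sign σ : ℤ) : R) * ∏ i, A (σ i) (τ i) := by
          rw [Finset.mul_sum]
          exact Finset.sum_congr rfl fun σ _ => by ring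
      _ = A.det := by rw [h1, ← mul_assoc, h2, one_mul]
  simp_rw [h]
  simp [Fintype.card_perm]

theorem det_pow_rev_sq {R : Type*} [CommRing R] {n : ℕ} (x : Fin n → R) :
    ∏ i, ∏ j ∈ Finset.Ioi i, (x i - x j) ^ 2 =
      (Matrix.of fun i j : Fin n => x i ^ (n - 1 - (j : ℕ))).det ^ 2 := by
  have h : (Matrix.of fun i j : Fin n => x i ^ (n - 1 - (j : ℕ))) =
      (Matrix.vandermonde x).submatrix id (Fin.revPerm : Equiv.Perm (Fin n)) := by
    ext i j
    simp only [Matrix.of_apply, Matrix.submatrix_apply, Matrix.vandermonde_apply, id,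
      Fin.revPerm_apply, Fin.val_rev]
    congr 1
    omega
  rw [h, Matrix.det_permute', mul_pow, Matrix.det_vandermonde]
  have h2 : ((Equiv.Perm.sign (Fin.revPerm : Equiv.Perm (Fin n)) : ℤ) : R) ^ 2 = 1 := by
    rw [sq, ← Int.cast_mul, ← Units.val_mul, Int.units_mul_self]; simp
  rw [h2, one_mul, ← Finset.prod_pow]
  refine Finset.prod_congr rfl fun i _ => ?_
  rw [← Finset.prod_pow]
  exact Finset.prod_congr rfl fun j _ => by ring

/-- Andréief's identity. -/
theorem Model.insertion_eq_det (M : Model) {n : ℕ} (g : Fin n → ℕ) (O : (Fin n → ℂ) → ℂ)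
    (hO : ∀ x : Fin n → ℂ,
      (Matrix.of fun i j : Fin n => x i ^ (n - 1 - (j : ℕ))).det ^ 2 * O x =
        (Matrix.of fun i j : Fin n => x i ^ (n - 1 - (j : ℕ))).det *
          (Matrix.of fun i j : Fin n => x i ^ g j).det)
    (hint : ∀ γ ∈ M.contour.support, ∀ i j : Fin n,
      IntegrableOn (M.momentIntegrand γ (n - 1 - (i : ℕ) + g j)) γ.domain) :
    M.insertion n O = (1 / (2 * Real.pi : ℂ)) ^ n * (M.momentMatrix g).det := by
  set H : Equiv.Perm (Fin n) × Equiv.Perm (Fin n) → Fin n → ℂ → ℂ := fun p i x =>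
    x ^ (n - 1 - (p.1 i : ℕ) + g (p.2 i)) * M.factor x * Complex.exp (-M.potential x) with hH
  have key : ∀ x : Fin n → ℂ,
      (∏ i, M.factor (x i) / (2 * Real.pi)) * (∏ i, ∏ j ∈ Finset.Ioi i, (x i - x j) ^ 2) *
        Complex.exp (-∑ i, M.potential (x i)) * O x =
      ∑ p : Equiv.Perm (Fin n) × Equiv.Perm (Fin n),
        ((1 / (2 * Real.pi : ℂ)) ^ n * (((Equiv.Perm.sign p.1 : ℤ) : ℂ) *
          ((Equiv.Perm.sign p.2 : ℤ) : ℂ))) * ∏ i, H p i (x i) := by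
    intro x
    rw [det_pow_rev_sq]
    have e1 : (∏ i, M.factor (x i) / (2 * Real.pi : ℂ)) =
        (1 / (2 * Real.pi : ℂ)) ^ n * ∏ i, M.factor (x i) := by
      simp_rw [div_eq_mul_one_div (M.factor _), Finset.prod_mul_distrib]
      rw [Finset.prod_const, Finset.card_univ, Fintype.card_fin, mul_comm]
    have e2 : Complex.exp (-∑ i, M.potential (x i)) = ∏ i, Complex.exp (-M.potential (x i)) := by
      rw [← Complex.exp_sum, Finset.sum_neg_distrib]
    have e3 := hO x
    -- Transposing puts the permutation on the exponents in the Leibniz formula, so that each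
    -- product runs over the variables `x i` in order.
    rw [← Matrix.det_transpose (Matrix.of fun i j : Fin n => x i ^ (n - 1 - (j : ℕ))),
      ← Matrix.det_transpose (Matrix.of fun i j : Fin n => x i ^ g j)] at e3
    rw [← Matrix.det_transpose (Matrix.of fun i j : Fin n => x i ^ (n - 1 - (j : ℕ)))]
    rw [mul_assoc, mul_assoc, mul_left_comm _ (Complex.exp _), e3, e1, e2]
    rw [Matrix.det_apply', Matrix.det_apply', Finset.sum_mul_sum, ← Finset.sum_product']
    simp only [Finset.univ_product_univ]
    rw [Finset.mul_sum, Finset.mul_sum]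
    refine Finset.sum_congr rfl fun p _ => ?_
    simp only [hH, Finset.prod_mul_distrib, pow_add, Matrix.transpose_apply, Matrix.of_apply]
    ring
  unfold Model.insertion
  simp_rw [key]
  rw [Contour.integral_sum_prod]
  · have h3 : ∀ p : Equiv.Perm (Fin n) × Equiv.Perm (Fin n),
        ∏ i, ∑ γ ∈ M.contour.support, M.contour γ * ∫ t in γ.domain,
          H p i (γ.toFun t) * deriv γ.toFun t = ∏ i, M.momentMatrix g (p.1 i) (p.2 i) := by
      intro p
      rfl
    simp_rw [h3, mul_assoc ((1 / (2 * Real.pi : ℂ)) ^ n)]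
    rw [← Finset.mul_sum, sum_sign_mul_sign_prod]
    have : (n.factorial : ℂ) ≠ 0 := by exact_mod_cast n.factorial_ne_zero
    field_simp
  · intro γ hγ p _ i
    exact hint γ hγ (p.1 i) (p.2 i)

/-- The exponents of the numerator of the Schur polynomial. -/
def schurExponent (lam : YoungDiagram) {n : ℕ} (j : Fin n) : ℕ := n - 1 - (j : ℕ) + lam.rowLen j

theorem Model.Converges.mono {M : Model} {n l l' : ℕ} (h : M.Converges n l) (hl : l' ≤ l) :
    M.Converges n l' := fun γ hγ k hk => h γ hγ k (by omega)

theorem Model.Converges.integrableOn_schur {M : Model} {n : ℕ} {lam : YoungDiagram}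
    (h : M.Converges n (lam.rowLen 0)) :
    ∀ γ ∈ M.contour.support, ∀ i j : Fin n,
      IntegrableOn (M.momentIntegrand γ (n - 1 - (i : ℕ) + schurExponent lam j)) γ.domain := by
  intro γ hγ i j
  refine h γ hγ _ ?_
  have := lam.rowLen_anti 0 j (Nat.zero_le _)
  have := i.2
  unfold schurExponent
  omega

theorem Model.insertion_schur (M : Model) {n : ℕ} (lam : YoungDiagram) (hlam : lam.colLen 0 ≤ n)
    (h : M.Converges n (lam.rowLen 0)) :
    M.insertion n (schur lam) = (1 / (2 * Real.pi : ℂ)) ^ n *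
      (M.momentMatrix (schurExponent lam (n := n))).det := by
  refine M.insertion_eq_det _ _ (fun x => ?_) h.integrableOn_schur
  rw [schur, if_pos hlam]
  -- At coinciding arguments the Vandermonde factor makes both sides zero, whatever value the
  -- quotient `0/0` takes.
  by_cases h0 : (Matrix.of fun i j : Fin n => x i ^ (n - 1 - (j : ℕ))).det = 0
  · simp [h0]
  · rw [sq, mul_assoc, mul_div_cancel₀ _ h0]; rfl

/-- This is not the case `⊥` of `Model.insertion_schur`: with division by zero equal to zero, `schur
⊥` is `0` and not `1` at coinciding arguments. -/
theorem Model.partitionFunction_eq_det (M : Model) {n : ℕ} (h : M.Converges n 0) :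
    M.partitionFunction n = (1 / (2 * Real.pi : ℂ)) ^ n *
      (M.momentMatrix (schurExponent ⊥ (n := n))).det := by
  refine M.insertion_eq_det _ _ (fun x => ?_)
    (Model.Converges.integrableOn_schur (lam := ⊥) (by rwa [rowLen_bot]))
  simp only [schurExponent, rowLen_bot, add_zero]
  ring

theorem Model.average_schur (M : Model) {n : ℕ} (lam : YoungDiagram) (hlam : lam.colLen 0 ≤ n)
    (h : M.Converges n (lam.rowLen 0)) :
    M.average n (schur lam) = (M.momentMatrix (schurExponent lam (n := n))).det /
      (M.momentMatrix (schurExponent ⊥ (n := n))).det := by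
  rw [Model.average, M.insertion_schur lam hlam h,
    M.partitionFunction_eq_det (h.mono (Nat.zero_le _)), mul_div_mul_left]
  exact pow_ne_zero _ (one_div_ne_zero (by simp [Real.pi_ne_zero]))

/-! ### Moments of the `r`-fold model -/

/-- A zero with nonzero derivative is isolated among the zeros, and isolated points are countably
many. This disposes of the points where a curve meets `0` and the laws of complex powers fail. -/
theorem ae_deriv_eq_zero_of_eq_zero {F : Type*} [NormedAddCommGroup F] [NormedSpace ℝ F]
    (f : ℝ → F) : ∀ᵐ t, f t = 0 → deriv f t = 0 := by
  have h : {t ∈ {t | f t = 0 ∧ deriv f t ≠ 0} |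
      nhdsWithin t ({t | f t = 0 ∧ deriv f t ≠ 0} ∩ Set.Ioi t) = ⊥}.Countable :=
    countable_setOfPred_isolated_right_within
  filter_upwards [h.ae_notMem volume] with t ht h0
  by_contra hd
  refine ht ⟨⟨h0, hd⟩, ?_⟩
  have hdiff : DifferentiableAt ℝ f t := by
    by_contra hn
    exact hd (deriv_zero_of_not_differentiableAt hn)
  have hne := hdiff.hasDerivAt.eventually_ne (c := (0 : F)) hd
  rw [← Filter.empty_mem_iff_bot]
  have h1 : {z | f z ≠ 0} ∈ nhdsWithin t ({t | f t = 0 ∧ deriv f t ≠ 0} ∩ Set.Ioi t) :=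
    nhdsWithin_mono t (fun z hz => (ne_of_gt hz.2 : z ≠ t)) hne
  filter_upwards [h1, self_mem_nhdsWithin] with z hz1 hz2
  exact hz1 hz2.1.1

theorem unitRoot_isPrimitiveRoot {r : ℕ} (hr : r ≠ 0) : IsPrimitiveRoot (unitRoot r) r :=
  Complex.isPrimitiveRoot_exp r hr

theorem unitRoot_ne_zero (r : ℕ) : unitRoot r ≠ 0 := Complex.exp_ne_zero _

theorem Curve.rotatedRoot_toFun_zero (r : ℕ) (γ : Curve) (t : ℝ) :
    (γ.rotatedRoot r 0).toFun t = γ.toFun t ^ ((1 : ℂ) / r) := by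
  simp [Curve.rotatedRoot]

theorem Curve.rotatedRoot_toFun (r j : ℕ) (γ : Curve) :
    (γ.rotatedRoot r j).toFun = fun t => unitRoot r ^ j * (γ.rotatedRoot r 0).toFun t := by
  simp [Curve.rotatedRoot]

theorem Curve.rotatedRoot_pow {r : ℕ} (hr : r ≠ 0) (j : ℕ) (γ : Curve) (t : ℝ) :
    (γ.rotatedRoot r j).toFun t ^ r = γ.toFun t := by
  simp only [Curve.rotatedRoot, mul_pow, one_div]
  rw [Complex.cpow_nat_inv_pow _ hr, ← pow_mul, mul_comm j, pow_mul,
    (unitRoot_isPrimitiveRoot hr).pow_eq_one, one_pow, one_mul]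

/-- The factor and the potential depend only on `x^r`, so the rotation is seen by `x^K` and by `dx`
alone. -/
theorem momentIntegrand_rotatedRoot (C : Contour) (W : ℂ → ℂ) {r : ℕ} (hr : r ≠ 0) (a : ℕ) (U : ℂ)
    (γ : Curve) (j K : ℕ) (t : ℝ) :
    (rfoldModel C W r a U).momentIntegrand (γ.rotatedRoot r j) K t =
      unitRoot r ^ (j * (K + 1)) *
        (rfoldModel C W r a U).momentIntegrand (γ.rotatedRoot r 0) K t := by
  have hd : deriv (γ.rotatedRoot r j).toFun t =
      unitRoot r ^ j * deriv (γ.rotatedRoot r 0).toFun t := by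
    rw [Curve.rotatedRoot_toFun, deriv_const_mul_field]
  simp only [Model.momentIntegrand, rfoldModel, Curve.rotatedRoot_pow hr, hd]
  rw [Curve.rotatedRoot_toFun]
  simp only [mul_pow, pow_mul, pow_succ]
  ring

/-- This is the substitution `y = x^r`, `dy = r x^{r-1} dx`. The hypothesis `hK` is the equality of
exponents `(K + U)/r = k + (U + a)/r + d + (r - 1)/r`. -/
theorem momentIntegrand_rfold_ae (C : Contour) (W : ℂ → ℂ) {r : ℕ} (hr : r ≠ 0) (a : ℕ) (U : ℂ)
    (γ : Curve)
    (hroot : ∀ᵐ t ∂volume.restrict γ.domain, DifferentiableAt ℝ (γ.rotatedRoot r 0).toFun t)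
    {k K : ℕ} {d : ℤ} (hK : (K : ℤ) + 1 = a + r * (k + 1 + d)) :
    (rfoldModel C W r a U).momentIntegrand (γ.rotatedRoot r 0) K
      =ᵐ[volume.restrict γ.domain] fun t =>
        (1 / (r : ℂ)) * (parentModel C W ((U + a) / r + d)).momentIntegrand γ k t := by
  have h0 : ∀ᵐ t ∂volume.restrict γ.domain, (γ.rotatedRoot r 0).toFun t = 0 →
      deriv (γ.rotatedRoot r 0).toFun t = 0 :=
    ae_restrict_of_ae (ae_deriv_eq_zero_of_eq_zero _)
  have hrc : (r : ℂ) ≠ 0 := by exact_mod_cast hr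
  filter_upwards [hroot, h0] with t ht h0t
  have hγ : γ.toFun = fun s => (γ.rotatedRoot r 0).toFun s ^ r := by
    funext s; rw [Curve.rotatedRoot_pow hr]
  have hd : deriv γ.toFun t =
      r * (γ.rotatedRoot r 0).toFun t ^ (r - 1) * deriv (γ.rotatedRoot r 0).toFun t := by
    rw [hγ]
    exact (ht.hasDerivAt.fun_pow r).deriv
  simp only [Model.momentIntegrand, rfoldModel, parentModel, Curve.rotatedRoot_pow hr, hd]
  by_cases hx : (γ.rotatedRoot r 0).toFun t = 0
  · rw [h0t hx]; simp
  have hz : γ.toFun t ≠ 0 := by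
    intro h
    apply hx
    rw [Curve.rotatedRoot_toFun_zero, h, Complex.zero_cpow (by simp [hr])]
  -- All powers are rewritten as principal powers of the same nonzero base `γ t`, where exponents
  -- add without any branch ambiguity.
  have e1 : ∀ m : ℕ, (γ.rotatedRoot r 0).toFun t ^ m = γ.toFun t ^ ((m : ℂ) / r) := by
    intro m
    rw [Curve.rotatedRoot_toFun_zero, ← Complex.cpow_nat_mul]
    congr 1; ring
  have e2 : (γ.rotatedRoot r 0).toFun t ^ K * γ.toFun t ^ (U / r) =
      γ.toFun t ^ k * γ.toFun t ^ ((U + a) / r + d) * (γ.rotatedRoot r 0).toFun t ^ (r - 1) := by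
    rw [e1, e1, ← Complex.cpow_natCast, ← Complex.cpow_add _ _ hz, ← Complex.cpow_add _ _ hz,
      ← Complex.cpow_add _ _ hz]
    congr 1
    have hK' : (K : ℂ) + 1 = a + r * (k + 1 + d) := by exact_mod_cast hK
    rw [Nat.cast_sub (Nat.one_le_iff_ne_zero.2 hr)]
    field_simp
    push_cast
    linear_combination hK'
  rw [e2]
  field_simp

theorem Contour.rfold_sum (r a : ℕ) (C : Contour) (I : Curve → ℂ) :
    ((C.rfold r a).sum fun γ c => c * I γ) =
      ∑ j ∈ Finset.range r, unitRoot r ^ (-((j : ℤ) * a)) *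
        C.sum fun γ c => c * I (γ.rotatedRoot r j) := by
  unfold Contour.rfold
  rw [← Finsupp.sum_finsetSum_index (by simp) (by intros; ring)]
  refine Finset.sum_congr rfl fun j _ => ?_
  rw [Finsupp.sum_smul_index (by simp), Finsupp.sum_mapDomain_index (by simp) (by intros; ring),
    Finsupp.mul_sum]
  exact Finsupp.sum_congr fun γ _ => by ring

theorem sum_unitRoot_zpow {r : ℕ} (hr : r ≠ 0) (m : ℤ) :
    ∑ j ∈ Finset.range r, (unitRoot r ^ m) ^ j = if (r : ℤ) ∣ m then (r : ℂ) else 0 := by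
  have hp := unitRoot_isPrimitiveRoot hr
  split_ifs with h
  · rw [(hp.zpow_eq_one_iff_dvd m).2 h]; simp
  · have h1 : unitRoot r ^ m ≠ 1 := fun h' => h ((hp.zpow_eq_one_iff_dvd m).1 h')
    rw [geom_sum_eq h1, ← zpow_natCast, ← zpow_mul, mul_comm, zpow_mul, zpow_natCast,
      hp.pow_eq_one]
    simp

theorem moment_rfold (C : Contour) (W : ℂ → ℂ) {r : ℕ} (hr : r ≠ 0) (a : ℕ) (U : ℂ) (K : ℕ) :
    (rfoldModel C W r a U).moment K =
      (if (r : ℤ) ∣ (K : ℤ) + 1 - a then (r : ℂ) else 0) *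
        C.sum fun γ c => c * ∫ t in γ.domain,
          (rfoldModel C W r a U).momentIntegrand (γ.rotatedRoot r 0) K t := by
  have h := Contour.rfold_sum r a C fun γ =>
    ∫ t in γ.domain, (rfoldModel C W r a U).momentIntegrand γ K t
  refine h.trans ?_
  rw [← sum_unitRoot_zpow hr, Finset.sum_mul]
  refine Finset.sum_congr rfl fun j _ => ?_
  rw [Finsupp.mul_sum, Finsupp.mul_sum]
  refine Finsupp.sum_congr fun γ _ => ?_
  simp_rw [momentIntegrand_rotatedRoot C W hr a U γ j K]
  rw [integral_const_mul]
  have e : (unitRoot r ^ ((K : ℤ) + 1 - a)) ^ j =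
      unitRoot r ^ (-((j : ℤ) * a)) * unitRoot r ^ (j * (K + 1)) := by
    rw [← zpow_natCast, ← zpow_natCast, ← zpow_mul, ← zpow_add₀ (unitRoot_ne_zero r)]
    congr 1
    push_cast
    ring
  rw [e]
  simp only [Curve.rotatedRoot]
  ring

theorem moment_rfold_of_not_dvd (C : Contour) (W : ℂ → ℂ) {r : ℕ} (hr : r ≠ 0) (a : ℕ) (U : ℂ)
    {K : ℕ} (hK : ¬ (r : ℤ) ∣ (K : ℤ) + 1 - a) : (rfoldModel C W r a U).moment K = 0 := by
  rw [moment_rfold C W hr, if_neg hK, zero_mul]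

/-- The `r` equal contributions of the rotations cancel the Jacobian factor `1 / r`. -/
theorem moment_rfold_eq_parent (C : Contour) (W : ℂ → ℂ) {r : ℕ} (hr : r ≠ 0) (a : ℕ) (U : ℂ)
    (hroot : ∀ γ ∈ C.support,
      ∀ᵐ t ∂volume.restrict γ.domain, DifferentiableAt ℝ (γ.rotatedRoot r 0).toFun t)
    {k K : ℕ} {d : ℤ} (hK : (K : ℤ) + 1 = a + r * (k + 1 + d)) :
    (rfoldModel C W r a U).moment K = (parentModel C W ((U + a) / r + d)).moment k := by
  rw [moment_rfold C W hr, if_pos ⟨k + 1 + d, by linarith⟩, Finsupp.mul_sum]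
  refine Finset.sum_congr rfl fun γ hγ => ?_
  beta_reduce
  rw [integral_congr_ae (momentIntegrand_rfold_ae C W hr a U γ (hroot γ hγ) hK),
    integral_const_mul]
  have hrc : (r : ℂ) ≠ 0 := by exact_mod_cast hr
  rw [one_div, mul_left_comm, mul_inv_cancel_left₀ hrc]
  rfl

/-! ### Transfer of convergence to the parent model. -/

theorem Curve.rotatedRoot_inj {r : ℕ} (hr : r ≠ 0) {γ γ' : Curve} {j j' : ℕ}
    (h : γ.rotatedRoot r j = γ'.rotatedRoot r j') : γ = γ' := by
  have h1 : (γ.rotatedRoot r j).domain = (γ'.rotatedRoot r j').domain := by rw [h]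
  have h2 : γ.toFun = γ'.toFun := by
    funext t
    rw [← Curve.rotatedRoot_pow hr j γ t, h, Curve.rotatedRoot_pow hr]
  cases γ; cases γ'; simp only [Curve.rotatedRoot] at h1 h2; subst h1; subst h2; rfl

theorem Curve.rotatedRoot_index_inj {r : ℕ} (hr : r ≠ 0) {γ : Curve} {t : ℝ}
    (ht : γ.toFun t ≠ 0) {j j' : ℕ} (hj : j < r) (hj' : j' < r)
    (h : γ.rotatedRoot r j = γ.rotatedRoot r j') : j = j' := by
  have h1 := congrFun (congrArg Curve.toFun h) t
  simp only [Curve.rotatedRoot] at h1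
  have h2 : γ.toFun t ^ ((1 : ℂ) / r) ≠ 0 := by
    rw [Complex.cpow_ne_zero_iff]; exact Or.inl ht
  exact (unitRoot_isPrimitiveRoot hr).pow_inj hj hj' (mul_right_cancel₀ h2 h1)

/-- A curve that is not identically zero has `r` distinct rotations, so no coefficients merge. For
the zero curve all rotations coincide and the phases may cancel. -/
theorem rotatedRoot_mem_support_rfold {r : ℕ} (hr : r ≠ 0) (a : ℕ) {C : Contour} {γ : Curve}
    (hγ : γ ∈ C.support) {t : ℝ} (ht : γ.toFun t ≠ 0) :
    γ.rotatedRoot r 0 ∈ (C.rfold r a).support := by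
  rw [Finsupp.mem_support_iff] at hγ ⊢
  have hinj : ∀ j, Function.Injective (Curve.rotatedRoot r j) :=
    fun j _ _ h => Curve.rotatedRoot_inj hr h
  have h1 : (C.rfold r a) (γ.rotatedRoot r 0) = C γ := by
    unfold Contour.rfold
    rw [Finsupp.finsetSum_apply, Finset.sum_eq_single 0]
    · rw [Finsupp.smul_apply, Finsupp.mapDomain_apply (hinj 0)]; simp
    · intro j hj hj0
      rw [Finsupp.smul_apply, Finsupp.mapDomain_of_notMem_range, smul_zero]
      rintro ⟨γ', h⟩
      obtain rfl := Curve.rotatedRoot_inj hr h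
      exact hj0 (Curve.rotatedRoot_index_inj hr ht (Finset.mem_range.1 hj)
        (Nat.pos_of_ne_zero hr) h)
    · intro h; exact absurd (Finset.mem_range.2 (Nat.pos_of_ne_zero hr)) h
  rwa [h1]

/-- Convergence of a moment of the `r`-fold model gives convergence of the corresponding moment
of the parent model. -/
theorem integrableOn_parent (C : Contour) (W : ℂ → ℂ) {r : ℕ} (hr : r ≠ 0) (a : ℕ) (U : ℂ)
    (hroot : ∀ γ ∈ C.support,
      ∀ᵐ t ∂volume.restrict γ.domain, DifferentiableAt ℝ (γ.rotatedRoot r 0).toFun t)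
    {n l : ℕ} (hconv : (rfoldModel C W r a U).Converges n l)
    {γ : Curve} (hγ : γ ∈ C.support)
    {k K : ℕ} {d : ℤ} (hK : (K : ℤ) + 1 = a + r * (k + 1 + d)) (hKn : K + 2 ≤ 2 * n + l) :
    IntegrableOn ((parentModel C W ((U + a) / r + d)).momentIntegrand γ k) γ.domain := by
  by_cases h0 : ∃ t, γ.toFun t ≠ 0
  · obtain ⟨t, ht⟩ := h0
    have h1 : IntegrableOn ((rfoldModel C W r a U).momentIntegrand (γ.rotatedRoot r 0) K)
        γ.domain := hconv _ (rotatedRoot_mem_support_rfold hr a hγ ht) K hKn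
    have h2 := (integrable_congr (momentIntegrand_rfold_ae C W hr a U γ (hroot γ hγ) hK)).1 h1
    have hrc : (r : ℂ) ≠ 0 := by exact_mod_cast hr
    have h3 := h2.const_mul (r : ℂ)
    refine h3.congr (Filter.Eventually.of_forall fun t => ?_)
    simp only
    field_simp
  -- The identically zero curve may be absent from the `r`-fold contour, but its derivative vanishes
  -- and so does the integrand.
  · push Not at h0
    have h1 : γ.toFun = fun _ => 0 := funext h0
    have h2 : (parentModel C W ((U + a) / r + d)).momentIntegrand γ k = fun _ => 0 := by
      funext t
      simp [Model.momentIntegrand, h1]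
    rw [h2]
    exact integrableOn_zero

/-! ### Block structure of the moment matrix of the `r`-fold model -/

/-- The least exponent `p` of the rows that are paired with the columns of residue `μ`. -/
def rowOffset (N r a μ : ℕ) : ℕ := (((a : ℤ) - N + μ) % r).toNat

/-- The rows suffice for all blocks. -/
def RowsFit (N r a : ℕ) : Prop :=
  ∀ μ < r, ∀ i < parentRank N r μ, rowOffset N r a μ + r * i < N

theorem cast_rowOffset_emod {N r a μ : ℕ} (hr : r ≠ 0) :
    (rowOffset N r a μ : ℤ) = ((a : ℤ) - N + μ) % r := by
  have := Int.emod_nonneg ((a : ℤ) - N + μ) (by omega : (r : ℤ) ≠ 0)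
  unfold rowOffset
  omega

theorem rowOffset_lt {N r a μ : ℕ} (hr : r ≠ 0) : rowOffset N r a μ < r := by
  have h1 := cast_rowOffset_emod (N := N) (a := a) (μ := μ) hr
  have h2 := Int.emod_lt_of_pos ((a : ℤ) - N + μ) (by omega : (0 : ℤ) < r)
  omega

/-- If `X = N - μ - a - 1`, then `a - N + μ = -X - 1` has remainder `r - 1 - (X mod r)`. This brings
in the floor that occurs in `u_μ`. -/
theorem cast_rowOffset {N r a μ : ℕ} (hr : r ≠ 0) :
    (rowOffset N r a μ : ℤ) = a - N + μ + r * (((N : ℤ) - μ - a - 1) / r + 1) := by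
  have hr' : (0 : ℤ) < r := by omega
  have h1 := Int.mul_ediv_add_emod ((N : ℤ) - μ - a - 1) r
  have h2 := Int.emod_nonneg ((N : ℤ) - μ - a - 1) hr'.ne'
  have h3 := Int.emod_lt_of_pos ((N : ℤ) - μ - a - 1) hr'
  rw [cast_rowOffset_emod hr]
  set q := ((N : ℤ) - μ - a - 1) / r
  have h4 : (a : ℤ) - N + μ =
      ((r : ℤ) - 1 - ((N : ℤ) - μ - a - 1) % r) + r * (-q - 1) := by linarith
  have h5 : ((a : ℤ) - N + μ) % r = (r : ℤ) - 1 - ((N : ℤ) - μ - a - 1) % r := by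
    rw [h4, Int.add_mul_emod_self_left]
    exact Int.emod_eq_of_lt (by omega) (by omega)
  rw [h5]
  linarith

theorem mod_eq_rowOffset {N r a μ p : ℕ} (hr : r ≠ 0) (h : (r : ℤ) ∣ p - ((a : ℤ) - N + μ)) :
    p % r = rowOffset N r a μ := by
  have h2 : (p : ℤ) % r = ((a : ℤ) - N + μ) % r :=
    Int.emod_eq_emod_iff_emod_sub_eq_zero.2 (Int.emod_eq_zero_of_dvd h)
  rw [← cast_rowOffset_emod hr] at h2
  exact_mod_cast h2

theorem cast_residue {r : ℕ} (hr : r ≠ 0) (lam : YoungDiagram) (I : ℕ) :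
    (residue r lam I : ℤ) = ((I : ℤ) - lam.rowLen I) % r := by
  have := Int.emod_nonneg ((I : ℤ) - lam.rowLen I) (by omega : (r : ℤ) ≠ 0)
  unfold residue
  omega

theorem dvd_sub_residue {r : ℕ} (hr : r ≠ 0) (lam : YoungDiagram) (I : ℕ) :
    (r : ℤ) ∣ ((I : ℤ) - lam.rowLen I) - residue r lam I := by
  rw [cast_residue hr]
  exact Int.dvd_self_sub_emod

/-- A model all of whose moments of order `K` with `K + 1` not congruent to `a` vanish. -/
def Model.Sparse (M : Model) (r a : ℕ) : Prop :=
  ∀ K : ℕ, ¬ (r : ℤ) ∣ (K : ℤ) + 1 - a → M.moment K = 0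

theorem Model.Sparse.dvd_of_entry_ne_zero {M : Model} {r a N : ℕ} (hr : r ≠ 0)
    (hM : M.Sparse r a) {lam : YoungDiagram} {i j : Fin N}
    (h : M.momentMatrix (schurExponent lam) i j ≠ 0) :
    (r : ℤ) ∣ ((N - 1 - (i : ℕ) : ℕ) : ℤ) - ((a : ℤ) - N + residue r lam j) := by
  have h1 : (r : ℤ) ∣ ((N - 1 - (i : ℕ) + schurExponent lam j : ℕ) : ℤ) + 1 - a := by
    by_contra hn
    exact h (hM _ hn)
  have h2 := Int.dvd_add h1 (dvd_sub_residue hr lam j)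
  have hj := j.2
  convert h2 using 1
  unfold schurExponent
  omega

/-- A nonzero Leibniz term gives the `n_μ` columns of residue `μ` distinct exponents `P s < N`
congruent to `rowOffset`. Were `rowOffset + r i ≥ N` for some `i < n_μ`, there would be at most `i`
such exponents. -/
theorem Model.Sparse.rowsFit {M : Model} {r a N : ℕ} (hr : r ≠ 0) (hM : M.Sparse r a)
    (h : (M.momentMatrix (schurExponent ⊥ (n := N))).det ≠ 0) : RowsFit N r a := by
  intro μ hμ i hi
  by_contra hn
  obtain ⟨σ, hσ⟩ := exists_perm_of_det_ne_zero h
  have hcol : ∀ s : Fin (parentRank N r μ), r * (s : ℕ) + μ < N :=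
    fun s => (lt_parentRank_iff hμ).1 s.2
  set P : Fin (parentRank N r μ) → ℕ := fun s => N - 1 - (σ ⟨r * (s : ℕ) + μ, hcol s⟩ : ℕ)
    with hP
  have hmod : ∀ s, P s % r = rowOffset N r a μ := by
    intro s
    apply mod_eq_rowOffset hr
    have h1 := hM.dvd_of_entry_ne_zero hr (hσ ⟨r * (s : ℕ) + μ, hcol s⟩)
    have h2 : residue r ⊥ (r * (s : ℕ) + μ) = μ := by
      rw [residue_bot, Nat.mul_add_mod, Nat.mod_eq_of_lt hμ]
    simp only [h2] at h1
    exact h1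
  have hdec : ∀ s, P s = rowOffset N r a μ + r * (P s / r) := by
    intro s
    rw [← hmod s, Nat.mod_add_div]
  have hlt : ∀ s, P s / r < i := by
    intro s
    have h1 : P s < N := by
      have := (σ ⟨r * (s : ℕ) + μ, hcol s⟩).2
      simp only [hP]
      omega
    by_contra hc
    have h2 : r * i ≤ r * (P s / r) := Nat.mul_le_mul_left _ (not_lt.1 hc)
    have := hdec s
    omega
  have hinj : Function.Injective fun s => (⟨P s / r, hlt s⟩ : Fin i) := by
    intro s s' hs
    have h1 : P s / r = P s' / r := congrArg Fin.val hs
    have h2 : P s = P s' := by rw [hdec s, hdec s', h1]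
    have h3 := (σ ⟨r * (s : ℕ) + μ, hcol s⟩).2
    have h4 := (σ ⟨r * (s' : ℕ) + μ, hcol s'⟩).2
    have h5 : σ ⟨r * (s : ℕ) + μ, hcol s⟩ = σ ⟨r * (s' : ℕ) + μ, hcol s'⟩ := by
      apply Fin.ext
      simp only [hP] at h2
      omega
    have h6 : r * (s : ℕ) + μ = r * (s' : ℕ) + μ := congrArg Fin.val (σ.injective h5)
    exact Fin.ext (Nat.eq_of_mul_eq_mul_left (Nat.pos_of_ne_zero hr) (Nat.add_right_cancel h6))
  have := Fintype.card_le_of_injective _ hinj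
  simp only [Fintype.card_fin] at this
  omega

/-- Match nonzero Leibniz terms for `λ` and for the empty partition: columns paired with the same
row have the same residue, so `τ⁻¹ σ` carries one residue count to the other. -/
theorem Model.Sparse.balanced {M : Model} {r a N : ℕ} (hr : r ≠ 0) (hM : M.Sparse r a)
    (h0 : (M.momentMatrix (schurExponent ⊥ (n := N))).det ≠ 0) {lam : YoungDiagram}
    (h : (M.momentMatrix (schurExponent lam (n := N))).det ≠ 0) : Balanced r N lam := by
  obtain ⟨σ, hσ⟩ := exists_perm_of_det_ne_zero h
  obtain ⟨τ, hτ⟩ := exists_perm_of_det_ne_zero h0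
  have hres : ∀ j : Fin N, residue r lam j = (τ.symm (σ j) : ℕ) % r := by
    intro j
    have h1 := hM.dvd_of_entry_ne_zero hr (hσ j)
    have h2 := hM.dvd_of_entry_ne_zero hr (hτ (τ.symm (σ j)))
    rw [Equiv.apply_symm_apply, residue_bot] at h2
    have h3 := Int.dvd_sub h2 h1
    have h4 : (residue r lam j : ℤ) ≡ ((τ.symm (σ j) : ℕ) % r : ℕ) [ZMOD r] := by
      apply Int.ModEq.symm
      rw [Int.modEq_iff_dvd]
      convert h3 using 1
      ring
    have h5 := Nat.ModEq.eq_of_lt_of_lt (Int.natCast_modEq_iff.1 h4) (residue_lt hr lam j)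
      (Nat.mod_lt _ (Nat.pos_of_ne_zero hr))
    exact h5
  intro μ _
  have hcount : ∀ (p : ℕ → Prop) [DecidablePred p],
      Nat.count p N = Fintype.card {i : Fin N // p i} := by
    intro p _
    let _ := Nat.CountSet.fintype p N
    rw [Nat.count_eq_card_fintype]
    refine Fintype.card_congr ⟨fun x => ⟨⟨x.1, x.2.1⟩, x.2.2⟩, fun x => ⟨x.1, x.1.2, x.2⟩,
      fun _ => rfl, fun _ => rfl⟩
  rw [hcount, hcount]
  exact Fintype.card_congr ((σ.trans τ.symm).subtypeEquiv fun j => by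
    rw [hres j]; rfl)

/-- The row paired with the `i`-th row of the block `μ`. -/
def rowMap {N r a : ℕ} (hfit : RowsFit N r a) (x : BlockIndex N r) : Fin N :=
  ⟨N - 1 - (rowOffset N r a x.1 + r * (parentRank N r x.1 - 1 - (x.2 : ℕ))), by
    have := hfit x.1 x.1.2 (parentRank N r x.1 - 1 - (x.2 : ℕ)) (by have := x.2.2; omega)
    omega⟩

theorem sub_rowMap {N r a : ℕ} (hfit : RowsFit N r a) (x : BlockIndex N r) :
    N - 1 - (rowMap hfit x : ℕ) =
      rowOffset N r a x.1 + r * (parentRank N r x.1 - 1 - (x.2 : ℕ)) := by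
  have := hfit x.1 x.1.2 (parentRank N r x.1 - 1 - (x.2 : ℕ)) (by have := x.2.2; omega)
  simp only [rowMap]
  omega

theorem rowOffset_inj {N r a μ μ' : ℕ} (hr : r ≠ 0) (hμ : μ < r) (hμ' : μ' < r)
    (h : rowOffset N r a μ = rowOffset N r a μ') : μ = μ' := by
  have h1 := cast_rowOffset_emod (N := N) (a := a) (μ := μ) hr
  rw [h, cast_rowOffset_emod hr] at h1
  have h2 : (μ' : ℤ) ≡ μ [ZMOD r] := Int.ModEq.add_left_cancel' _ h1
  exact (Nat.ModEq.eq_of_lt_of_lt (Int.natCast_modEq_iff.1 h2) hμ' hμ).symm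

theorem rowMap_bijective {N r a : ℕ} (hr : r ≠ 0) (hfit : RowsFit N r a) :
    Function.Bijective (rowMap hfit) := by
  rw [Fintype.bijective_iff_injective_and_card]
  -- The blocks have `N` positions in all, as the enumeration for the empty partition shows.
  refine ⟨?_, Fintype.card_congr (columnEquiv hr (balanced_bot r N))⟩
  rintro ⟨μ, s⟩ ⟨μ', s'⟩ h
  have h1 : N - 1 - (rowMap hfit ⟨μ, s⟩ : ℕ) = N - 1 - (rowMap hfit ⟨μ', s'⟩ : ℕ) := by rw [h]
  rw [sub_rowMap, sub_rowMap] at h1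
  simp only at h1
  have h2 := congrArg (· % r) h1
  simp only [Nat.add_mul_mod_self_left, Nat.mod_eq_of_lt (rowOffset_lt hr)] at h2
  have h3 : μ = μ' := Fin.ext (rowOffset_inj hr μ.2 μ'.2 h2)
  subst h3
  have h4 := Nat.eq_of_mul_eq_mul_left (Nat.pos_of_ne_zero hr) (Nat.add_left_cancel h1)
  have h5 : s = s' := Fin.ext (by have := s.2; have := s'.2; omega)
  rw [h5]

def rowEquiv {N r a : ℕ} (hr : r ≠ 0) (hfit : RowsFit N r a) : BlockIndex N r ≃ Fin N :=
  Equiv.ofBijective _ (rowMap_bijective hr hfit)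

theorem sub_rowEquiv {N r a : ℕ} (hr : r ≠ 0) (hfit : RowsFit N r a) (x : BlockIndex N r) :
    N - 1 - (rowEquiv hr hfit x : ℕ) =
      rowOffset N r a x.1 + r * (parentRank N r x.1 - 1 - (x.2 : ℕ)) := sub_rowMap hfit x

/-- The dependence of the sign on `λ` is isolated in `rSignature`; the other sign involves only `e`
and the empty partition and cancels in averages. -/
theorem det_reindex_columns {r N : ℕ} (hr : r ≠ 0) {lam : YoungDiagram}
    (hlam : lam.colLen 0 ≤ N) (hb : Balanced r N lam) (e : BlockIndex N r ≃ Fin N)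
    (A : Matrix (Fin N) (Fin N) ℂ) :
    A.det = (rSignature r lam : ℂ) *
      (Equiv.Perm.sign (e.symm.trans (columnEquiv hr (balanced_bot r N))) : ℤ) *
        (A.submatrix e (columnEquiv hr hb)).det := by
  have h1 : A.submatrix e (columnEquiv hr hb) =
      (A.submatrix id (e.symm.trans (columnEquiv hr hb) : Equiv.Perm (Fin N))).submatrix e e := by
    ext x y
    simp
  rw [h1, Matrix.det_submatrix_equiv_self, Matrix.det_permute', hb.rSignature_eq hr hlam]
  have h2 : e.symm.trans (columnEquiv hr (balanced_bot r N)) =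
      ((columnEquiv hr hb).symm.trans (columnEquiv hr (balanced_bot r N)) : Equiv.Perm (Fin N)) *
        (e.symm.trans (columnEquiv hr hb) : Equiv.Perm (Fin N)) := by
    ext x
    simp
  rw [h2, Equiv.Perm.sign_mul]
  have h3 : ∀ u : ℤˣ, ((u : ℤ) : ℂ) * ((u : ℤ) : ℂ) = 1 := fun u => by
    rw [← Int.cast_mul, ← Units.val_mul, Int.units_mul_self]; simp
  push_cast
  linear_combination (-A.det) * h3 (Equiv.Perm.sign (e.symm.trans (columnEquiv hr hb))) *
      (((Equiv.Perm.sign ((columnEquiv hr hb).symm.trans (columnEquiv hr (balanced_bot r N))) : ℤ)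
        : ℂ) * ((Equiv.Perm.sign ((columnEquiv hr hb).symm.trans
          (columnEquiv hr (balanced_bot r N))) : ℤ) : ℂ)) -
    A.det * h3 (Equiv.Perm.sign ((columnEquiv hr hb).symm.trans
      (columnEquiv hr (balanced_bot r N))))

/-- The integer shift of the parameter of the parent model. -/
def parentShift (N r a μ : ℕ) : ℤ := ((N : ℤ) - μ - a - 1) / r - ((N : ℤ) - μ - 1) / r

theorem parentParam_eq (N r a : ℕ) (U : ℂ) (μ : ℕ) :
    parentParam N r a U μ = (U + a) / r + (parentShift N r a μ : ℂ) := by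
  unfold parentParam parentShift
  push_cast
  ring

theorem cast_rowOffset_eq_shift {N r a μ : ℕ} (hr : r ≠ 0) (hμ : μ < r) :
    (rowOffset N r a μ : ℤ) =
      a - N + μ + r * (parentShift N r a μ + parentRank N r μ) := by
  rw [cast_rowOffset hr, cast_parentRank hμ, parentShift]
  ring

/-! ### Rows of the quotient and factorisation into parent models. -/

theorem Balanced.mul_rowLen_quotient {r N : ℕ} {lam : YoungDiagram}
    (hlam : lam.colLen 0 ≤ N) (hb : Balanced r N lam) (μ : Fin r) (s : ℕ) :
    (r : ℤ) * (quotient r lam μ).rowLen s =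
      r * s + lam.rowLen (rowOfResidue r lam μ s) - rowOfResidue r lam μ s + μ := by
  rw [rowLen_quotient, quotientRow, hb.coreRemainder_eq_zero hlam μ.2, mul_add,
    mul_quotient_div lam μ.2]
  ring

theorem Balanced.rowLen_quotient_eq_zero {r N : ℕ} {lam : YoungDiagram}
    (hlam : lam.colLen 0 ≤ N) (hb : Balanced r N lam) (μ : Fin r) {s : ℕ}
    (hs : parentRank N r μ ≤ s) : (quotient r lam μ).rowLen s = 0 := by
  have h : lam.colLen 0 ≤ rowOfResidue r lam μ s := by
    refine hlam.trans ?_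
    rw [← count_mod_eq_parentRank μ.2, ← hb μ μ.2] at hs
    exact (Nat.count_le_iff_le_nth (residue_infinite lam μ.2)).1 hs
  have h1 := rowLen_quotient r lam μ s
  rw [quotientRow_eq_zero lam μ.2 h] at h1
  exact_mod_cast h1

theorem Balanced.colLen_quotient_le {r N : ℕ} {lam : YoungDiagram}
    (hlam : lam.colLen 0 ≤ N) (hb : Balanced r N lam) (μ : Fin r) :
    (quotient r lam μ).colLen 0 ≤ parentRank N r μ := by
  by_contra hc
  have h1 := YoungDiagram.mem_iff_lt_colLen.2 (not_le.1 hc)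
  have h2 := YoungDiagram.mem_iff_lt_rowLen.1 h1
  rw [hb.rowLen_quotient_eq_zero hlam μ le_rfl] at h2
  exact lt_irrefl _ h2

section Models

variable {C : Contour} {W : ℂ → ℂ} {r a N : ℕ} {U : ℂ}

theorem rfoldModel_sparse (hr : r ≠ 0) : (rfoldModel C W r a U).Sparse r a :=
  fun _ hK => moment_rfold_of_not_dvd C W hr a U hK

/-- The determinant of moments of the `r`-fold model factorises into those of the parent models. -/
theorem det_momentMatrix_rfold (hr : r ≠ 0) (hfit : RowsFit N r a)
    (hroot : ∀ γ ∈ C.support,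
      ∀ᵐ t ∂volume.restrict γ.domain, DifferentiableAt ℝ (γ.rotatedRoot r 0).toFun t)
    {lam : YoungDiagram} (hlam : lam.colLen 0 ≤ N) (hb : Balanced r N lam) :
    ((rfoldModel C W r a U).momentMatrix (schurExponent lam (n := N))).det =
      (rSignature r lam : ℂ) * (Equiv.Perm.sign
        ((rowEquiv hr hfit).symm.trans (columnEquiv hr (balanced_bot r N))) : ℤ) *
      ∏ μ : Fin r, ((parentModel C W (parentParam N r a U μ)).momentMatrix
        (schurExponent (quotient r lam μ) (n := parentRank N r μ))).det := by
  rw [det_reindex_columns hr hlam hb (rowEquiv hr hfit), det_eq_prod_of_sigma]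
  · congr 1
    refine Finset.prod_congr rfl fun μ _ => ?_
    congr 1
    ext i s
    simp only [Matrix.of_apply, Matrix.submatrix_apply, Model.momentMatrix, sub_rowEquiv,
      schurExponent, columnEquiv_apply, parentParam_eq]
    apply moment_rfold_eq_parent C W hr a U hroot
    have h1 := cast_rowOffset_eq_shift (N := N) (a := a) hr μ.2
    have h2 := hb.mul_rowLen_quotient hlam μ s
    have h3 := hb.rowOfResidue_lt μ.2 s.2
    have hi := i.2
    have hs := s.2
    rw [Nat.sub_sub, Nat.sub_sub, Nat.sub_sub]
    push_cast [Nat.cast_sub (show 1 + (i : ℕ) ≤ parentRank N r μ by omega),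
      Nat.cast_sub (show 1 + (s : ℕ) ≤ parentRank N r μ by omega),
      Nat.cast_sub (show 1 + rowOfResidue r lam μ s ≤ N by omega)]
    -- `h1` matches the row exponents with the shift in `u_μ`, and `h2` matches the column exponents
    -- with the parts of the quotient.
    linear_combination h1 - h2
  · intro x y hxy
    by_contra hne
    apply hxy
    have h1 := (rfoldModel_sparse hr).dvd_of_entry_ne_zero hr hne
    have h2 := mod_eq_rowOffset hr h1
    rw [sub_rowEquiv, Nat.add_mul_mod_self_left, Nat.mod_eq_of_lt (rowOffset_lt hr),
      columnEquiv_apply, residue_rowOfResidue lam y.1.2] at h2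
    exact Fin.ext (rowOffset_inj hr x.1.2 y.1.2 h2)

theorem parentModel_converges (hr : r ≠ 0) (hfit : RowsFit N r a)
    (hroot : ∀ γ ∈ C.support,
      ∀ᵐ t ∂volume.restrict γ.domain, DifferentiableAt ℝ (γ.rotatedRoot r 0).toFun t)
    {m l : ℕ} (hconv : (rfoldModel C W r a U).Converges N m) {μ : ℕ} (hμ : μ < r)
    (hl : r * l ≤ m + μ) (h0 : parentRank N r μ = 0 → l = 0) :
    (parentModel C W (parentParam N r a U μ)).Converges (parentRank N r μ) l := by
  intro γ hγ k hk
  -- For an empty block `h0` gives `l = 0`, and then no order `k` is required to converge.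
  have hn : 0 < parentRank N r μ := by
    by_contra hc
    have := h0 (by omega)
    omega
  obtain ⟨n, hn'⟩ : ∃ n, parentRank N r μ = n + 1 := ⟨_, (Nat.sub_add_cancel hn).symm⟩
  have h1 := hfit μ hμ n (by omega)
  have h2 : r * n + μ < N := (lt_parentRank_iff hμ).1 (by omega)
  have h3 := cast_rowOffset_eq_shift (N := N) (a := a) hr hμ
  have h4 : r * k ≤ r * (2 * n + l) := Nat.mul_le_mul_left _ (by omega)
  have h5 : r * (2 * n + l) = 2 * (r * n) + r * l := by ring
  rw [parentParam_eq]
  -- `K` is the order corresponding to `k`. As `k ≤ 2n + l`, it is at most `(rowOffset + r n) + (N -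
  -- 1 - μ) + r l ≤ 2N - 2 + m`, by `hfit` and `hl`.
  refine integrableOn_parent C W hr a U hroot hconv hγ
    (K := rowOffset N r a μ + r * k + (N - 1 - μ - r * n)) ?_ (by omega)
  rw [hn'] at h3
  have h6 : ((N - 1 - μ - r * n : ℕ) : ℤ) = N - 1 - μ - r * n := by omega
  push_cast [h6] at h3 ⊢
  linear_combination h3

end Models

end MatrixModel

end

/-! ### The factorisation theorem. -/

open MatrixModel in
theorem mainTheorem5 (C : MatrixModel.Contour) (W : ℂ → ℂ) (r a N : ℕ) (ha : a < r) (U : ℂ)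
    (lam : YoungDiagram) (hlam : lam.colLen 0 ≤ N)
    (hC : ∀ γ ∈ C.support, γ.IsSmooth)
    (hroot : ∀ γ ∈ C.support,
      ∀ᵐ t ∂volume.restrict γ.domain, DifferentiableAt ℝ (γ.rotatedRoot r 0).toFun t)
    (hconv : (MatrixModel.rfoldModel C W r a U).Converges N (lam.rowLen 0))
    (hZ : (MatrixModel.rfoldModel C W r a U).partitionFunction N ≠ 0) :
    (∀ μ : Fin r,
      (MatrixModel.parentModel C W (MatrixModel.parentParam N r a U μ)).Converges (MatrixModel.parentRank N r μ) 0 ∧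
      (MatrixModel.parentModel C W (MatrixModel.parentParam N r a U μ)).partitionFunction (MatrixModel.parentRank N r μ) ≠ 0) ∧
    (MatrixModel.rSignature r lam ≠ 0 → ∀ μ : Fin r,
      (MatrixModel.parentModel C W (MatrixModel.parentParam N r a U μ)).Converges (MatrixModel.parentRank N r μ)
        ((MatrixModel.quotient r lam μ).rowLen 0)) ∧
    (MatrixModel.rfoldModel C W r a U).average N (MatrixModel.schur lam) =
      (MatrixModel.rSignature r lam : ℂ) *
        ∏ μ : Fin r,
          (MatrixModel.parentModel C W (MatrixModel.parentParam N r a U μ)).average (MatrixModel.parentRank N r μ)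
            (MatrixModel.schur (MatrixModel.quotient r lam μ)) := by
  have hr : r ≠ 0 := by omega
  have hpi : ∀ n : ℕ, (1 / (2 * Real.pi : ℂ)) ^ n ≠ 0 := fun n =>
    pow_ne_zero _ (one_div_ne_zero (by simp [Real.pi_ne_zero]))
  have hdet0 : ((rfoldModel C W r a U).momentMatrix (schurExponent ⊥ (n := N))).det ≠ 0 := by
    rw [Model.partitionFunction_eq_det _ (hconv.mono (Nat.zero_le _))] at hZ
    exact right_ne_zero_of_mul hZ
  have hfit : RowsFit N r a := (rfoldModel_sparse hr).rowsFit hr hdet0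
  have hconv0 : ∀ μ : Fin r, (parentModel C W (parentParam N r a U μ)).Converges
      (parentRank N r μ) 0 := fun μ =>
    parentModel_converges hr hfit hroot hconv μ.2 (by omega) fun _ => rfl
  have hquot : ∀ (μ : Fin r) (n : ℕ),
      schurExponent (quotient r ⊥ μ) (n := n) = schurExponent ⊥ (n := n) := by
    intro μ n
    funext j
    simp only [schurExponent, rowLen_quotient_bot, rowLen_bot]
  have hfac0 := det_momentMatrix_rfold (W := W) (U := U) hr hfit hroot
    (lam := ⊥) (by rw [colLen_bot]; exact Nat.zero_le _) (balanced_bot r N)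
  simp only [hquot, rSignature_bot r hr, Int.cast_one, one_mul] at hfac0
  -- Factorising the nonzero determinant for `λ = ∅` shows that no parent determinant vanishes.
  have hprod := hdet0
  rw [hfac0] at hprod
  have hconvq : rSignature r lam ≠ 0 → ∀ μ : Fin r,
      (parentModel C W (parentParam N r a U μ)).Converges (parentRank N r μ)
        ((quotient r lam μ).rowLen 0) := by
    intro hδ μ
    have hb := (rSignature_ne_zero_iff hr hlam).1 hδ
    refine parentModel_converges hr hfit hroot hconv μ.2 ?_
      fun h0 => hb.rowLen_quotient_eq_zero hlam μ h0.le
    -- With `I = I_{μ,0}`, the first part `q` of the quotient satisfies `r q = λ_I - I + μ ≤ λ_0 +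
    -- μ`.
    have h1 := hb.mul_rowLen_quotient hlam μ 0
    have h2 := lam.rowLen_anti 0 (rowOfResidue r lam μ 0) (Nat.zero_le _)
    push_cast at h1
    zify
    zify at h2
    linarith [Int.natCast_nonneg (rowOfResidue r lam μ 0)]
  refine ⟨fun μ => ⟨hconv0 μ, ?_⟩, hconvq, ?_⟩
  · rw [Model.partitionFunction_eq_det _ (hconv0 μ)]
    exact mul_ne_zero (hpi _)
      (Finset.prod_ne_zero_iff.1 (right_ne_zero_of_mul hprod) μ (Finset.mem_univ μ))
  · rw [Model.average_schur _ lam hlam hconv]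
    by_cases hδ : rSignature r lam = 0
    · have h0 : ((rfoldModel C W r a U).momentMatrix (schurExponent lam (n := N))).det = 0 := by
        by_contra hne
        exact (rSignature_ne_zero_iff hr hlam).2 ((rfoldModel_sparse hr).balanced hr hdet0 hne) hδ
      rw [h0, hδ]
      simp
    · have hb := (rSignature_ne_zero_iff hr hlam).1 hδ
      -- The sign common to `λ` and the empty partition cancels, leaving `δ_r(λ)` and the block
      -- ratios.
      rw [det_momentMatrix_rfold hr hfit hroot hlam hb, hfac0, mul_assoc, mul_left_comm,
        mul_div_mul_left _ _ (left_ne_zero_of_mul hprod), mul_div_assoc, ← Finset.prod_div_distrib]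
      congr 1
      refine Finset.prod_congr rfl fun μ _ => ?_
      rw [Model.average_schur _ _ (hb.colLen_quotient_le hlam μ) (hconvq hδ μ)]
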